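/- Let $S^1$ be the unit circle in $\mathbb R^2$. A subset of $S^{n-1}$ is \emph{$m$-tame} if each of its non-empty subsets with at most $m$ points lies in an open hemisphere. A subset $U\subseteq S^{n-1}$ is \emph{weakly maxtame} if it is open and $n$-tame, has finitely many components, and is maximal amongst the open $n$-tame sets with at most as many components as $U$; it is \emph{maxtame} if moreover it is maximal amongst all open $n$-tame subsets of $S^{n-1}$. Let $\mathcal S$ be the set of maxtame subsets of $S^1$. For odd $\ell$ and $v=(v_1,\dots,v_\ell)\in(S^1)^\ell$ let $U_v$ be the interior of the closure of $\{z\in S^1:\prod_j\det(v_j,z)>0\}$; this is a maxtame set by (1) below. Give $\mathcal S$ the final topology for the maps $(S^1)^\ell\to\mathcal S$, $v\mapsto U_v$, over all odd $\ell$. Let $\mathcal C$ be the set of subsets of $\mathbb{RP}^1$ with a finite odd number of points, with the final topology for the maps $(\mathbb{RP}^1)^\ell\to\mathcal C$ ($\ell$ odd) that send $(x_1,\dots,x_\ell)$ to the set of points occurring an odd number of times among the $x_i$ (so that $\mathcal C$ is the direct limit of the quotients $C_\ell$ of $(\mathbb{RP}^1)^\ell$ in which the order is forgotten and equal entries cancel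 in pairs). Let $S^\infty=\bigcup_n S^n$ be the infinite sphere, the set of finitely supported real sequences of norm one with the direct limit topology. Then: (1) for every odd $\ell$ and every $v\in(S^1)^\ell$ the set $U_v$ is maxtame. (2) The boundary of each maxtame set $U\subset S^1$ consists of an odd number of pairs of antipodal points, that is, it is the full preimage of a configuration $\pi(U)\in\mathcal C$ under the double cover $S^1\to\mathbb{RP}^1$. Each configuration in $\mathcal C$ arises in this way from exactly two maxtame sets, and $\pi:\mathcal S\to\mathcal C$ is a covering map. The space $\mathcal S$ is connected, so it is a connected double cover of $\mathcal C$. (3) The configuration space $\mathcal S$ of maxtame subsets of $S^1$ is homeomorphic to $S^\infty$. -/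

import Mathlib

open scoped Topology

/-- The unit sphere `S^{n-1}` in Euclidean `n`-space. -/
abbrev USphere (n : ℕ) : Type := Metric.sphere (0 : EuclideanSpace ℝ (Fin n)) 1

/-- `V` is `m`-tame: every non-empty subset of `V` with at most `m` points lies in some open
hemisphere `{x | 0 < ⟪w, x⟫}`, where `w` is a point of the sphere. -/
def IsTame {n : ℕ} (m : ℕ) (V : Set (USphere n)) : Prop :=
  ∀ s : Finset (USphere n), s.Nonempty → s.card ≤ m → (s : Set (USphere n)) ⊆ V →
    ∃ w : USphere n, ∀ x ∈ s, 0 < inner ℝ (w : EuclideanSpace ℝ (Fin n)) x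

/-- The number of connected components of `V` (possibly infinite). -/
noncomputable def numComponents {n : ℕ} (V : Set (USphere n)) : ℕ∞ :=
  ENat.card (ConnectedComponents V)

/-- `U ⊆ S^{n-1}` is weakly maxtame: it is open and `n`-tame, has finitely many components, and is
maximal amongst the open `n`-tame sets with at most as many components as `U`. -/
structure IsWeaklyMaxtame {n : ℕ} (U : Set (USphere n)) : Prop where
  isOpen : IsOpen U
  tame : IsTame n U
  finite_components : numComponents U < ⊤
  maximal : ∀ V : Set (USphere n), IsOpen V → IsTame n V → numComponents V ≤ numComponents U →
    U ⊆ V → V = U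

/-- A weakly maxtame set is maxtame if it is maximal amongst all open `n`-tame subsets. -/
structure IsMaxtame {n : ℕ} (U : Set (USphere n)) : Prop where
  weakly : IsWeaklyMaxtame U
  maximal : ∀ V : Set (USphere n), IsOpen V → IsTame n V → U ⊆ V → V = U

/-- The unit circle `S^1` in the Euclidean plane. -/
abbrev Circ : Type := USphere 2

/-! ### The configuration space of maxtame subsets of the circle -/

/-- For `v = (v_1, …, v_ℓ)` the set `U_v`, the interior of the closure of
`{z | 0 < ∏_j det (v_j, z)}`. The product changes its sign at the points `± v_j` that occur an odd
number of times; at the remaining zeros it does not, and the interior of the closure fills them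
in. -/
def signRegion {l : ℕ} (v : Fin l → Circ) : Set Circ :=
  interior (closure {z : Circ | 0 < ∏ j, ((v j).1 0 * z.1 1 - (v j).1 1 * z.1 0)})

/-- The set of all maxtame subsets of the circle. -/
def MaxtameSpace : Type := {U : Set Circ // IsMaxtame U}

/-- The map `v ↦ U_v` on tuples of `l` points of the circle, as a map to the set of maxtame sets
(defined wherever `U_v` is maxtame; for odd `l` that is everywhere). -/
def toMaxtame (l : ℕ) (v : {v : Fin l → Circ // IsMaxtame (signRegion v)}) : MaxtameSpace :=
  ⟨signRegion v.1, v.2⟩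

/-- The topology of the configuration space: the final topology for the maps
`(S^1)^l → MaxtameSpace`, `v ↦ U_v`, with `l` odd. So the boundary points of a maxtame set move
continuously, colliding boundary points cancel in pairs, and the space is the union (with the
direct limit topology) of the quotient spaces of the `(S^1)^l`. -/
instance MaxtameSpace.instTopologicalSpace : TopologicalSpace MaxtameSpace :=
  ⨆ (l : ℕ) (_ : Odd l), TopologicalSpace.coinduced (toMaxtame l) inferInstance

/-! ### The configuration space of odd numbers of points on the real projective line -/

/-- The antipodal equivalence relation on the circle. -/
def antipodalSetoid : Setoid Circ where
  r x y := x = y ∨ x = -y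
  iseqv :=
    { refl := fun _ => Or.inl rfl
      symm := by
        rintro x y (h | h)
        · exact Or.inl h.symm
        · exact Or.inr (by rw [h, neg_neg])
      trans := by
        rintro x y z (h | h) (h' | h')
        · exact Or.inl (h.trans h')
        · exact Or.inr (h.trans h')
        · exact Or.inr (by rw [h, h'])
        · exact Or.inl (by rw [h, h', neg_neg]) }

/-- The real projective line, with the quotient topology. -/
abbrev RPLine : Type := Quotient antipodalSetoid

/-- The double cover `S^1 → ℝP^1`. -/
def toRPLine (x : Circ) : RPLine := Quotient.mk antipodalSetoid x

/-- The set of all configurations of an odd number of distinct points on `ℝP^1`. -/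
def OddConfig : Type := {F : Finset RPLine // Odd F.card}

open Classical in
/-- The set of the points that occur an odd number of times in `x`: equal entries cancel in
pairs. -/
noncomputable def oddPart {l : ℕ} (x : Fin l → RPLine) : Finset RPLine :=
  (Finset.univ.image x).filter fun p => Odd (Finset.univ.filter fun i => x i = p).card

lemma odd_card_oddPart {l : ℕ} (hl : Odd l) (x : Fin l → RPLine) : Odd (oddPart x).card := by
  classical
  unfold oddPart
  rw [← Finset.odd_sum_iff_odd_card_odd]
  have h := Finset.card_eq_sum_card_image x (Finset.univ : Finset (Fin l))
  rw [Finset.card_univ, Fintype.card_fin] at h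
  convert hl using 1
  exact h.symm

/-- The map `(ℝP^1)^l → OddConfig` for odd `l`. -/
noncomputable def toOddConfig (l : ℕ) (hl : Odd l) (x : Fin l → RPLine) : OddConfig :=
  ⟨oddPart x, odd_card_oddPart hl x⟩

/-- The topology of the configuration space of odd numbers of points: the union, with the direct
limit topology, of the quotient spaces `C_l` of `(ℝP^1)^l` (`l` odd) in which order is forgotten
and equal entries cancel in pairs. -/
noncomputable instance OddConfig.instTopologicalSpace : TopologicalSpace OddConfig :=
  ⨆ (l : ℕ) (hl : Odd l), TopologicalSpace.coinduced (toOddConfig l hl) inferInstance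

/-! ### The infinite sphere -/

/-- The set of finitely supported real sequences of Euclidean norm one. -/
def InfiniteSphere : Type := {x : ℕ →₀ ℝ // (x.sum fun _ a => a ^ 2) = 1}

lemma sum_sq_mapDomain (n : ℕ) (x : USphere (n + 1)) :
    (((Finsupp.equivFunOnFinite.symm (fun i => x.1 i)).mapDomain Fin.val : ℕ →₀ ℝ).sum
      fun _ a => a ^ 2) = 1 := by
  rw [Finsupp.sum_mapDomain_index_inj Fin.val_injective, Finsupp.sum_fintype _ _ (by simp)]
  have h : ‖x.1‖ = 1 := by simp
  have h2 := EuclideanSpace.real_norm_sq_eq x.1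
  rw [h] at h2
  simpa using h2.symm

/-- The standard inclusion `S^n → S^∞`, extension by zero. -/
noncomputable def sphereIncl (n : ℕ) (x : USphere (n + 1)) : InfiniteSphere :=
  ⟨(Finsupp.equivFunOnFinite.symm (fun i => x.1 i)).mapDomain Fin.val, sum_sq_mapDomain n x⟩

/-- `S^∞` is the union of the spheres `S^0 ⊆ S^1 ⊆ S^2 ⊆ …` with the direct limit topology. -/
noncomputable instance InfiniteSphere.instTopologicalSpace : TopologicalSpace InfiniteSphere :=
  ⨆ n : ℕ, TopologicalSpace.coinduced (sphereIncl n) inferInstance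

/-! On the circle, `2`-tame means free of antipodal pairs (`isTame_two_iff`). A product of an odd
number of linear forms is an odd function with finitely many zeros, so its positive region cannot be
enlarged without creating an antipodal pair: `U_v` is maxtame. Conversely, a maxtame `U` has
finitely many components, each an arc with at most two missing endpoints. Its frontier is finite and
is the complement of `U ∪ -U`, and `U` and `-U` alternate across every frontier point. Hence the
function that is `1` on `U` and `-1` on `-U` has, up to a global sign, the sign of the product of
the linear forms vanishing on the frontier (`IsMaxtame.classification`). Oddness forces an odd
number of lines, and the two global signs give the two sheets `U`, `-U`.

The homeomorphism rests on duality for the `L¹` norm of forms. Since `x² + y² = 1`, the forms of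
degree `2n+1` restricted to the circle contain all those of smaller odd degree, and `formBasis` is a
basis adapted to this filtration. The moments of `U` are the integrals of its sign function against
that basis. For a form with finitely many zeros the gradient of the `L¹` norm is the vector of
moments of its sign (`hasDerivAt_integral_abs`). Maximising a linear functional relative to this
norm therefore realises every direction of `ℝ^(2n+2)` by a `2n+1`-tuple (`exists_tupleMoment_eq`),
and the equality case of `∫ sign(q) p ≤ ∫ |p|` shows that the direction determines the region
(`signRegion_eq_of_tupleMoment`). So the regions of `2n+1`-tuples form a sphere `S^(2n+1)`.

These identifications do not yet fit together: the higher moments of a `2n+1`-tuple need not vanish.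
They are, however, continuous homogeneous functions of the first `2n+2` moments
(`exists_momentExt`), and subtracting them is a triangular change of coordinates, `shear`. Sheared
moments of `2n+1`-tuples vanish from index `2n+2` on, so the normalised maps to the spheres are
compatible; being quotient maps from compact tori, they pass to a homeomorphism of the direct
limits.

The map to configurations is the quotient by the antipodal involution. Moments are odd under it and
never all zero, so a neighbourhood on which one moment keeps its sign is disjoint from its antipode;
this gives the covering. Connectedness holds because any two maxtame sets lie in the image of one
torus. -/

/-! ### The circle, antipodes and the area form -/

/-- The Euclidean plane. -/
abbrev Plane : Type := EuclideanSpace ℝ (Fin 2)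

namespace Circ

lemma coe_neg_apply (x : Circ) (i : Fin 2) : (-x).1 i = -x.1 i := rfl

lemma sq_add_sq (x : Circ) : x.1 0 ^ 2 + x.1 1 ^ 2 = 1 := by
  have h : ‖x.1‖ = 1 := by simp
  have h2 := EuclideanSpace.real_norm_sq_eq x.1
  rw [h, Fin.sum_univ_two] at h2
  linarith

lemma ext_coords {x y : Circ} (h0 : x.1 0 = y.1 0) (h1 : x.1 1 = y.1 1) : x = y := by
  apply Subtype.ext
  ext i
  fin_cases i
  · exact h0
  · exact h1

/-- The point of the circle with given coordinates. -/
noncomputable def mk (a b : ℝ) (h : a ^ 2 + b ^ 2 = 1) : Circ :=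
  ⟨!₂[a, b], by
    rw [mem_sphere_zero_iff_norm, EuclideanSpace.norm_eq, Real.sqrt_eq_one, Fin.sum_univ_two]
    simpa using h⟩

@[simp] lemma mk_zero (a b : ℝ) (h : a ^ 2 + b ^ 2 = 1) : (mk a b h).1 0 = a := by simp [mk]

@[simp] lemma mk_one (a b : ℝ) (h : a ^ 2 + b ^ 2 = 1) : (mk a b h).1 1 = b := by simp [mk]

lemma continuous_coord (i : Fin 2) : Continuous fun x : Circ => x.1 i := by fun_prop

lemma neg_ne_self (x : Circ) : -x ≠ x := by
  intro h
  have h0 := congrArg (fun y : Circ => y.1 0) h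
  have h1 := congrArg (fun y : Circ => y.1 1) h
  simp only [coe_neg_apply] at h0 h1
  have := sq_add_sq x
  have h0' : x.1 0 = 0 := by linarith
  have h1' : x.1 1 = 0 := by linarith
  rw [h0', h1'] at this
  norm_num at this

instance : ConnectedSpace Circ :=
  isConnected_iff_connectedSpace.mp
    (isConnected_sphere (by simp [← Module.finrank_eq_rank]) 0 zero_le_one)

instance : Nontrivial Circ := ⟨⟨-mk 1 0 (by norm_num), mk 1 0 (by norm_num), neg_ne_self _⟩⟩

lemma dense_compl_of_finite {s : Set Circ} (hs : s.Finite) : Dense sᶜ := by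
  simpa [Set.compl_eq_univ_sdiff] using (dense_univ (X := Circ)).sdiff_finite hs

/-- The circle has no isolated points. This is the means of perturbing a point inside an open set
off the finitely many zeros of a product of linear forms. -/
lemma inter_nonempty_of_finite_compl {s U : Set Circ} (hs : sᶜ.Finite) (hU : IsOpen U)
    (hne : U.Nonempty) : (U ∩ s).Nonempty := by
  have := (dense_compl_of_finite hs).inter_open_nonempty U hU hne
  rwa [compl_compl] at this

end Circ

open Circ

/-- The area form `det (v, x)`. -/
def wedge (v x : Circ) : ℝ := v.1 0 * x.1 1 - v.1 1 * x.1 0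

/-- The scalar product. -/
def dotp (v x : Circ) : ℝ := v.1 0 * x.1 0 + v.1 1 * x.1 1

lemma wedge_neg_right (v x : Circ) : wedge v (-x) = -wedge v x := by
  simp only [wedge, coe_neg_apply]; ring

lemma wedge_neg_left (v x : Circ) : wedge (-v) x = -wedge v x := by
  simp only [wedge, coe_neg_apply]; ring

lemma wedge_self (v : Circ) : wedge v v = 0 := by simp only [wedge]; ring

lemma dotp_self (v : Circ) : dotp v v = 1 := by
  have := sq_add_sq v; simp only [dotp]; linarith

lemma dotp_sq_add_wedge_sq (v x : Circ) : dotp v x ^ 2 + wedge v x ^ 2 = 1 := by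
  have h1 := sq_add_sq v
  have h2 := sq_add_sq x
  calc dotp v x ^ 2 + wedge v x ^ 2
      = (v.1 0 ^ 2 + v.1 1 ^ 2) * (x.1 0 ^ 2 + x.1 1 ^ 2) := by simp only [dotp, wedge]; ring
    _ = 1 := by rw [h1, h2, one_mul]

/-- Together with `coord_one_eq`: expansion in the orthonormal frame consisting of `v` and `v`
turned by a right angle. -/
lemma coord_zero_eq (v x : Circ) : x.1 0 = dotp v x * v.1 0 - wedge v x * v.1 1 := by
  have h1 := sq_add_sq v
  simp only [dotp, wedge]
  linear_combination (-x.1 0) * h1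

lemma coord_one_eq (v x : Circ) : x.1 1 = dotp v x * v.1 1 + wedge v x * v.1 0 := by
  have h1 := sq_add_sq v
  simp only [dotp, wedge]
  linear_combination (-x.1 1) * h1

lemma wedge_eq_zero_iff {v x : Circ} : wedge v x = 0 ↔ x = v ∨ x = -v := by
  constructor
  · intro h
    have h0 := coord_zero_eq v x
    have h1 := coord_one_eq v x
    have h2 := dotp_sq_add_wedge_sq v x
    rw [h] at h0 h1 h2
    have h3 : (dotp v x - 1) * (dotp v x + 1) = 0 := by linarith
    rcases mul_eq_zero.mp h3 with h4 | h4
    · left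
      have : dotp v x = 1 := by linarith
      rw [this] at h0 h1
      exact ext_coords (by linarith) (by linarith)
    · right
      have : dotp v x = -1 := by linarith
      rw [this] at h0 h1
      exact ext_coords (by rw [coe_neg_apply]; linarith) (by rw [coe_neg_apply]; linarith)
  · rintro (rfl | rfl)
    · exact wedge_self _
    · rw [wedge_neg_right, wedge_self, neg_zero]

lemma eq_of_wedge_eq_zero_of_dotp_pos {v x : Circ} (h : wedge v x = 0) (h' : 0 < dotp v x) :
    x = v := by
  rcases wedge_eq_zero_iff.mp h with h1 | h1
  · exact h1
  · have h2 := dotp_self v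
    rw [h1] at h'
    simp only [dotp, coe_neg_apply] at h' h2
    linarith

lemma continuous_wedge : Continuous fun p : Circ × Circ => wedge p.1 p.2 := by
  unfold wedge; fun_prop

lemma continuous_wedge_right (v : Circ) : Continuous (wedge v) := by
  unfold wedge; fun_prop

lemma continuous_dotp_right (v : Circ) : Continuous (dotp v) := by
  unfold dotp; fun_prop

/-- The area form as a linear functional of its second argument. -/
noncomputable def wedgeL (v : Circ) : Plane →L[ℝ] ℝ :=
  v.1 0 • EuclideanSpace.proj 1 - v.1 1 • EuclideanSpace.proj 0

lemma wedgeL_apply (v x : Circ) : wedgeL v x.1 = wedge v x := by simp [wedgeL, wedge]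

/-- The scalar product as a linear functional of its second argument. -/
noncomputable def dotpL (v : Circ) : Plane →L[ℝ] ℝ :=
  v.1 0 • EuclideanSpace.proj 0 + v.1 1 • EuclideanSpace.proj 1

lemma dotpL_apply (v x : Circ) : dotpL v x.1 = dotp v x := by simp [dotpL, dotp]

/-- The part of the circle in an intersection of open half planes is connected. -/
lemma isPreconnected_cone (S : Set (Plane →L[ℝ] ℝ)) (hS : S.Nonempty) :
    IsPreconnected {x : Circ | ∀ φ ∈ S, 0 < φ x.1} := by
  set C : Set Plane := {z | ∀ φ ∈ S, 0 < φ z} with hC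
  obtain ⟨φ₀, hφ₀⟩ := hS
  have hconv : Convex ℝ C := by
    intro x hx y hy a b ha hb hab φ hφ
    rw [map_add, map_smul, map_smul, smul_eq_mul, smul_eq_mul]
    have h1 := hx φ hφ
    have h2 := hy φ hφ
    rcases ha.eq_or_lt with rfl | ha'
    · have : b = 1 := by linarith
      subst this; linarith
    · have := mul_pos ha' h1
      have := mul_nonneg hb h2.le
      linarith
  have hne : ∀ z ∈ C, z ≠ 0 := by
    rintro z hz rfl
    have := hz φ₀ hφ₀
    simp at this
  -- The set on the circle is the radial projection of a convex cone that avoids the origin.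
  have himg : Subtype.val '' {x : Circ | ∀ φ ∈ S, 0 < φ x.1} = (fun z : Plane => ‖z‖⁻¹ • z) '' C := by
    ext z
    constructor
    · rintro ⟨x, hx, rfl⟩
      exact ⟨x.1, hx, by simp⟩
    · rintro ⟨y, hy, rfl⟩
      have hy0 : 0 < ‖y‖ := norm_pos_iff.mpr (hne y hy)
      refine ⟨⟨‖y‖⁻¹ • y, ?_⟩, fun φ hφ => ?_, rfl⟩
      · rw [mem_sphere_zero_iff_norm, norm_smul, norm_inv, norm_norm, inv_mul_cancel₀ hy0.ne']
      · rw [map_smul, smul_eq_mul]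
        exact mul_pos (inv_pos.mpr hy0) (hy φ hφ)
  rw [← Topology.IsInducing.subtypeVal.isPreconnected_image, himg]
  refine hconv.isPreconnected.image _ ?_
  intro z hz
  have : ‖z‖ ≠ 0 := norm_ne_zero_iff.mpr (hne z hz)
  exact ((continuous_norm.continuousAt.inv₀ this).smul continuousAt_id).continuousWithinAt

lemma mem_closure_wedge_side (z : Circ) {ε : ℝ} (hε : ε = 1 ∨ ε = -1) :
    z ∈ closure {x | 0 < ε * wedge z x} := by
  -- The point `z` rotated by `t`; rotation by `ε t` has area form `sin (ε t)` with `z`, so small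
  -- positive `t` approaches `z` from the prescribed side.
  have hmem : ∀ t : ℝ, (Real.cos t * z.1 0 - Real.sin t * z.1 1) ^ 2
      + (Real.cos t * z.1 1 + Real.sin t * z.1 0) ^ 2 = 1 := by
    intro t
    have h1 := sq_add_sq z
    have h2 := Real.sin_sq_add_cos_sq t
    linear_combination (Real.sin t ^ 2 + Real.cos t ^ 2) * h1 + h2
  let γ : ℝ → Circ := fun t => mk _ _ (hmem (ε * t))
  have hγ : Continuous γ := by
    apply Continuous.subtype_mk
    fun_prop
  have hγ0 : γ 0 = z := ext_coords (by simp [γ]) (by simp [γ])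
  have h0 : (0 : ℝ) ∈ closure (Set.Ioo 0 Real.pi) := by
    rw [closure_Ioo Real.pi_pos.ne]
    exact Set.left_mem_Icc.mpr Real.pi_pos.le
  have := image_closure_subset_closure_image hγ (Set.mem_image_of_mem γ h0)
  rw [hγ0] at this
  refine closure_mono ?_ this
  rintro _ ⟨t, ht, rfl⟩
  have h1 := sq_add_sq z
  have : wedge z (γ t) = Real.sin (ε * t) := by
    simp only [wedge, γ, mk_zero, mk_one]
    linear_combination Real.sin (ε * t) * h1
  rw [Set.mem_ofPred_eq, this]
  have := Real.sin_pos_of_mem_Ioo ht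
  rcases hε with rfl | rfl
  · simpa
  · simpa

/-- The product of the area forms of `v_1, …, v_l`. -/
def wedgeProd {l : ℕ} (v : Fin l → Circ) (x : Circ) : ℝ := ∏ j, wedge (v j) x

lemma signRegion_eq {l : ℕ} (v : Fin l → Circ) :
    signRegion v = interior (closure {z | 0 < wedgeProd v z}) := rfl

lemma continuous_wedgeProd {l : ℕ} (v : Fin l → Circ) : Continuous (wedgeProd v) :=
  continuous_finsetProd _ fun j _ => continuous_wedge_right (v j)

lemma wedgeProd_neg_right {l : ℕ} (v : Fin l → Circ) (x : Circ) :
    wedgeProd v (-x) = (-1) ^ l * wedgeProd v x := by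
  simp only [wedgeProd, wedge_neg_right]
  rw [Finset.prod_neg, Finset.card_univ, Fintype.card_fin]

lemma wedgeProd_neg_left {l : ℕ} (v : Fin l → Circ) (x : Circ) :
    wedgeProd (-v) x = (-1) ^ l * wedgeProd v x := by
  simp only [wedgeProd, Pi.neg_apply, wedge_neg_left]
  rw [Finset.prod_neg, Finset.card_univ, Fintype.card_fin]

lemma wedgeProd_eq_zero_iff {l : ℕ} (v : Fin l → Circ) (x : Circ) :
    wedgeProd v x = 0 ↔ ∃ j, x = v j ∨ x = -v j := by
  simp only [wedgeProd, Finset.prod_eq_zero_iff, Finset.mem_univ, true_and, wedge_eq_zero_iff]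

lemma finite_wedgeProd_zeros {l : ℕ} (v : Fin l → Circ) : {x | wedgeProd v x = 0}.Finite := by
  have : {x | wedgeProd v x = 0} ⊆ Set.range v ∪ Set.range (-v) := by
    intro x hx
    obtain ⟨j, h | h⟩ := (wedgeProd_eq_zero_iff v x).mp hx
    · exact Or.inl ⟨j, h.symm⟩
    · exact Or.inr ⟨j, h.symm⟩
  exact ((Set.finite_range _).union (Set.finite_range _)).subset this

lemma wedgeProd_append {k l : ℕ} (v : Fin k → Circ) (w : Fin l → Circ) (x : Circ) :
    wedgeProd (Fin.append v w) x = wedgeProd v x * wedgeProd w x := by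
  simp [wedgeProd, Fin.prod_univ_add]

lemma wedgeProd_cons {l : ℕ} (a : Circ) (v : Fin l → Circ) (x : Circ) :
    wedgeProd (Fin.cons a v : Fin (l + 1) → Circ) x = wedge a x * wedgeProd v x := by
  simp [wedgeProd, Fin.prod_univ_succ]

/-- A neighbourhood of `z` that meets only those lines `ℝ w_j` which pass through `z`. -/
def lineNhd {l : ℕ} (w : Fin l → Circ) (z : Circ) : Set Circ :=
  {x | 0 < dotp z x ∧ ∀ j, wedge (w j) z ≠ 0 → 0 < wedge (w j) z * wedge (w j) x}

lemma isOpen_lineNhd {l : ℕ} (w : Fin l → Circ) (z : Circ) : IsOpen (lineNhd w z) := by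
  have h : lineNhd w z = {x | 0 < dotp z x} ∩
      ⋂ j, {x | wedge (w j) z ≠ 0 → 0 < wedge (w j) z * wedge (w j) x} := by
    ext x; simp [lineNhd]
  rw [h]
  refine (isOpen_lt continuous_const (continuous_dotp_right z)).inter (isOpen_iInter_of_finite ?_)
  intro j
  by_cases hj : wedge (w j) z = 0
  · simp [hj]
  · simp only [ne_eq, hj, not_false_eq_true, true_imp_iff]
    exact isOpen_lt continuous_const (continuous_const.mul (continuous_wedge_right _))

lemma self_mem_lineNhd {l : ℕ} (w : Fin l → Circ) (z : Circ) : z ∈ lineNhd w z :=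
  ⟨by rw [dotp_self]; exact one_pos, fun _ hj => mul_self_pos.mpr hj⟩

lemma isPreconnected_lineNhd_side {l : ℕ} (w : Fin l → Circ) (z : Circ) (ε : ℝ) :
    IsPreconnected (lineNhd w z ∩ {x | 0 < ε * wedge z x}) := by
  have := isPreconnected_cone ({dotpL z, ε • wedgeL z} ∪
    (fun j => wedge (w j) z • wedgeL (w j)) '' {j | wedge (w j) z ≠ 0}) ⟨dotpL z, by simp⟩
  convert this using 1
  ext x
  simp only [lineNhd, Set.mem_inter_iff, Set.mem_ofPred_eq, Set.union_def, Set.mem_insert_iff,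
    Set.mem_singleton_iff, or_imp, forall_and, forall_eq, Set.forall_mem_image, dotpL_apply,
    smul_apply, wedgeL_apply, smul_eq_mul]
  tauto

/-! ### Tame sets on the circle -/

lemma inner_circ (x y : Circ) : inner ℝ x.1 y.1 = dotp x y := by
  simp [PiLp.inner_apply, Fin.sum_univ_two, dotp, mul_comm]

/-- The centre is the normalised bisector `x + y`, nonzero because `y ≠ -x`; with `s = ‖x + y‖²`,
both scalar products equal `s / (2 √s)`. -/
lemma exists_hemisphere_pair {x y : Circ} (h : y ≠ -x) :
    ∃ w : Circ, 0 < dotp w x ∧ 0 < dotp w y := by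
  have hx := sq_add_sq x
  have hy := sq_add_sq y
  set s : ℝ := (x.1 0 + y.1 0) ^ 2 + (x.1 1 + y.1 1) ^ 2 with hs
  have hs0 : 0 < s := by
    rcases (by positivity : 0 ≤ s).eq_or_lt with h0 | h0
    · exfalso
      apply h
      have h1 : x.1 0 + y.1 0 = 0 := by nlinarith [sq_nonneg (x.1 0 + y.1 0), sq_nonneg (x.1 1 + y.1 1)]
      have h2 : x.1 1 + y.1 1 = 0 := by nlinarith [sq_nonneg (x.1 0 + y.1 0), sq_nonneg (x.1 1 + y.1 1)]
      exact ext_coords (by rw [coe_neg_apply]; linarith) (by rw [coe_neg_apply]; linarith)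
    · exact h0
  have hr : 0 < √s := Real.sqrt_pos.mpr hs0
  have hsq : √s ^ 2 = s := Real.sq_sqrt hs0.le
  have hmem : ((x.1 0 + y.1 0) / √s) ^ 2 + ((x.1 1 + y.1 1) / √s) ^ 2 = 1 := by
    rw [div_pow, div_pow, ← add_div, hsq, ← hs, div_self hs0.ne']
  refine ⟨mk _ _ hmem, ?_, ?_⟩
  · have : dotp (mk _ _ hmem) x = s / 2 / √s := by
      simp only [dotp, mk_zero, mk_one]
      field_simp
      linear_combination hx - hy - hs
    rw [this]; positivity
  · have : dotp (mk _ _ hmem) y = s / 2 / √s := by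
      simp only [dotp, mk_zero, mk_one]
      field_simp
      linear_combination hy - hx - hs
    rw [this]; positivity

lemma dotp_neg_right (v x : Circ) : dotp v (-x) = -dotp v x := by
  simp only [dotp, coe_neg_apply]; ring

/-- A subset of the circle is `2`-tame if and only if it contains no antipodal pair. -/
lemma isTame_two_iff (V : Set Circ) : IsTame 2 V ↔ ∀ x ∈ V, -x ∉ V := by
  classical
  constructor
  · intro h x hx hx'
    obtain ⟨w, hw⟩ := h {x, -x} ⟨x, by simp⟩ Finset.card_le_two
      (by intro y hy; simp at hy; rcases hy with rfl | rfl <;> assumption)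
    have h1 := hw x (by simp)
    have h2 := hw (-x) (by simp)
    rw [inner_circ] at h1 h2
    rw [dotp_neg_right] at h2
    linarith
  · intro h s hs hcard hsV
    have key : ∀ x y : Circ, x ∈ V → y ∈ V → s ⊆ {x, y} →
        ∃ w : Circ, ∀ z ∈ s, 0 < inner ℝ (w : Plane) z := by
      intro x y hx hy hsub
      obtain ⟨w, h1, h2⟩ := exists_hemisphere_pair (x := x) (y := y)
        (by rintro rfl; exact h x hx hy)
      refine ⟨w, fun z hz => ?_⟩
      have := hsub hz
      rw [Finset.mem_insert, Finset.mem_singleton] at this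
      rw [inner_circ]
      rcases this with rfl | rfl <;> assumption
    have hpos := hs.card_pos
    interval_cases hc : s.card
    · obtain ⟨x, rfl⟩ := Finset.card_eq_one.mp hc
      have hx : x ∈ V := hsV (by simp)
      exact key x x hx hx (by simp)
    · obtain ⟨x, y, -, rfl⟩ := Finset.card_eq_two.mp hc
      exact key x y (hsV (by simp)) (hsV (by simp)) subset_rfl

/-! ### The regions `U_v` -/

section SignRegion

variable {l : ℕ} (v : Fin l → Circ)

lemma isOpen_signRegion : IsOpen (signRegion v) := isOpen_interior

lemma mem_signRegion_of_pos {x : Circ} (hx : 0 < wedgeProd v x) : x ∈ signRegion v := by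
  rw [signRegion_eq]
  exact interior_maximal subset_closure (isOpen_lt continuous_const (continuous_wedgeProd v)) hx

lemma nonneg_of_mem_closure {x : Circ} (hx : x ∈ closure {z | 0 < wedgeProd v z}) :
    0 ≤ wedgeProd v x := by
  have : closure {z | 0 < wedgeProd v z} ⊆ {z | 0 ≤ wedgeProd v z} :=
    closure_minimal (fun z (hz : 0 < wedgeProd v z) => hz.le) (isClosed_le continuous_const (continuous_wedgeProd v))
  exact this hx

lemma nonneg_of_mem_signRegion {x : Circ} (hx : x ∈ signRegion v) : 0 ≤ wedgeProd v x :=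
  nonneg_of_mem_closure v (interior_subset hx)

lemma closure_signRegion : closure (signRegion v) = closure {z | 0 < wedgeProd v z} := by
  apply subset_antisymm
  · exact closure_minimal interior_subset isClosed_closure
  · exact closure_mono fun x hx => mem_signRegion_of_pos v hx

lemma finite_compl_wedgeProd_ne : {x | wedgeProd v x ≠ 0}ᶜ.Finite := by
  convert finite_wedgeProd_zeros v using 1
  ext x; simp

/-- An open set on which the product is nonnegative lies in the region. -/
lemma subset_signRegion {V : Set Circ} (hV : IsOpen V) (h : ∀ x ∈ V, 0 ≤ wedgeProd v x) :
    V ⊆ signRegion v := by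
  rw [signRegion_eq]
  refine interior_maximal ?_ hV
  intro x hx
  rw [mem_closure_iff]
  intro O hO hxO
  obtain ⟨y, ⟨hyO, hyV⟩, hy⟩ := inter_nonempty_of_finite_compl (finite_compl_wedgeProd_ne v)
    (hO.inter hV) ⟨x, hxO, hx⟩
  exact ⟨y, hyO, lt_of_le_of_ne (h y hyV) (Ne.symm hy)⟩

variable {v}

/-- The product is nonnegative on the region and odd, so on the open set where the region meets its
antipode it would vanish identically, against the finiteness of its zeros. -/
lemma neg_notMem_signRegion (hl : Odd l) {x : Circ} (hx : x ∈ signRegion v) :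
    -x ∉ signRegion v := by
  intro hx'
  have hopen : IsOpen (signRegion v ∩ (fun y => -y) ⁻¹' signRegion v) :=
    (isOpen_signRegion v).inter ((isOpen_signRegion v).preimage continuous_neg)
  obtain ⟨y, ⟨hy1, hy2⟩, hy⟩ := inter_nonempty_of_finite_compl (finite_compl_wedgeProd_ne v)
    hopen ⟨x, hx, hx'⟩
  have h1 := nonneg_of_mem_signRegion v hy1
  have h2 := nonneg_of_mem_signRegion v hy2
  rw [wedgeProd_neg_right, hl.neg_one_pow] at h2
  exact hy (by linarith)

lemma pos_ofOdd {x : Circ} (hl : Odd l) (hx : wedgeProd v x < 0) : 0 < wedgeProd v (-x) := by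
  rw [wedgeProd_neg_right, hl.neg_one_pow]; linarith

/-- A point of `V` with negative product would have its antipode in the region, hence in `V`; so the
product is nonnegative on `V`. -/
lemma signRegion_maximal (hl : Odd l) {V : Set Circ} (hV : IsOpen V) (ht : IsTame 2 V)
    (hsub : signRegion v ⊆ V) : V = signRegion v := by
  refine subset_antisymm (subset_signRegion v hV fun x hx => ?_) hsub
  by_contra! hneg
  exact (isTame_two_iff V).mp ht x hx (hsub (mem_signRegion_of_pos v (pos_ofOdd hl hneg)))

/-- The points at which the signs of the `det (v_j, x)` are prescribed. -/
def signCell (v : Fin l → Circ) (σ : Fin l → SignType) : Set Circ :=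
  {x | ∀ j, SignType.sign (wedge (v j) x) = σ j}

lemma isPreconnected_signCell (hl : 0 < l) {σ : Fin l → SignType} (hσ : ∀ j, σ j ≠ 0) :
    IsPreconnected (signCell v σ) := by
  have := isPreconnected_cone (Set.range fun j => (σ j : ℝ) • wedgeL (v j)) ⟨_, ⟨⟨0, hl⟩, rfl⟩⟩
  convert this using 1
  ext x
  simp only [signCell, Set.mem_ofPred_eq, Set.forall_mem_range, smul_apply,
    wedgeL_apply, smul_eq_mul]
  refine forall_congr' fun j => ?_
  have := hσ j
  rcases h : σ j
  · exact absurd h this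
  · simp [sign_eq_neg_one_iff]
  · simp [sign_eq_one_iff]

/-- Components are open by local connectedness, so each meets the dense union and thus contains a
nonempty piece; the finitely many pieces exhaust the components. -/
lemma numComponents_lt_top_of_dense {n : ℕ} {ι : Type*} [Finite ι] {V : Set (USphere n)}
    [LocallyConnectedSpace V]
    (C : ι → Set V) (hC : ∀ i, IsPreconnected (C i)) (hd : Dense (⋃ i, C i)) :
    numComponents V < ⊤ := by
  classical
  have : Finite (ConnectedComponents V) := by
    let f : {i : ι // (C i).Nonempty} → ConnectedComponents V := fun i => (i.2.choose : V)
    refine Finite.of_surjective f fun c => ?_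
    obtain ⟨x, rfl⟩ := ConnectedComponents.surjective_coe c
    obtain ⟨y, hy1, hy2⟩ := hd.inter_open_nonempty (connectedComponent x)
      isOpen_connectedComponent ⟨x, mem_connectedComponent⟩
    obtain ⟨i, hi⟩ := Set.mem_iUnion.mp hy2
    refine ⟨⟨i, ⟨y, hi⟩⟩, ?_⟩
    have hne : (C i).Nonempty := ⟨y, hi⟩
    have h1 : hne.choose ∈ connectedComponent y :=
      (hC i).subset_connectedComponent hi hne.choose_spec
    have h2 : connectedComponent y = connectedComponent x := (connectedComponent_eq hy1).symm
    rw [h2] at h1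
    exact ConnectedComponents.coe_eq_coe'.mpr h1
  exact ENat.card_lt_top_of_finite

instance : LocallyConnectedSpace Circ :=
  have : Fact (Module.finrank ℝ Plane = 1 + 1) := ⟨by simp⟩
  ChartedSpace.locallyConnectedSpace (EuclideanSpace ℝ (Fin 1)) Circ

/-- The cells of the line arrangement with positive sign product are connected and dense in the
region. Density suffices, so the filled-in even zeros need no care. -/
lemma numComponents_signRegion_lt_top (hl : 0 < l) : numComponents (signRegion v) < ⊤ := by
  have : LocallyConnectedSpace (signRegion v) := (isOpen_signRegion v).locallyConnectedSpace
  let ι := {σ : Fin l → SignType // (∀ j, σ j ≠ 0) ∧ ∏ j, σ j = 1}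
  have hprod : ∀ x, ∏ j, SignType.sign (wedge (v j) x) = SignType.sign (wedgeProd v x) :=
    fun x => (map_prod signHom (fun j => wedge (v j) x) Finset.univ).symm
  refine numComponents_lt_top_of_dense (ι := ι)
    (fun σ => (Subtype.val ⁻¹' signCell v σ.1 : Set (signRegion v))) ?_ ?_
  · intro σ
    rw [← Topology.IsInducing.subtypeVal.isPreconnected_image, Set.image_preimage_eq_of_subset]
    · exact isPreconnected_signCell hl σ.2.1
    · rw [Subtype.range_coe]
      intro x hx
      apply mem_signRegion_of_pos
      have := σ.2.2
      rwa [← Finset.prod_congr rfl fun j _ => hx j, hprod, sign_eq_one_iff] at this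
  · have hd : ∀ x : signRegion v, x.1 ∈ closure {z | 0 < wedgeProd v z} := fun x => interior_subset x.2
    intro x
    rw [closure_subtype]
    refine closure_mono ?_ (hd x)
    intro z hz
    refine ⟨⟨z, mem_signRegion_of_pos v hz⟩, ?_, rfl⟩
    rw [Set.mem_iUnion]
    refine ⟨⟨fun j => SignType.sign (wedge (v j) z), ?_, ?_⟩, ?_⟩
    · intro j
      rw [sign_ne_zero]
      exact (Finset.prod_ne_zero_iff.mp (ne_of_gt (show 0 < wedgeProd v z from hz))) j (Finset.mem_univ j)
    · rw [hprod, sign_pos hz]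
    · intro j; rfl

/-- The regions of odd products are maxtame. -/
theorem isMaxtame_signRegion (hl : Odd l) (v : Fin l → Circ) : IsMaxtame (signRegion v) where
  weakly :=
    { isOpen := isOpen_signRegion v
      tame := (isTame_two_iff _).mpr fun _ hx => neg_notMem_signRegion hl hx
      finite_components := numComponents_signRegion_lt_top hl.pos
      maximal := fun _ hV ht _ hsub => signRegion_maximal hl hV ht hsub }
  maximal := fun _ hV ht hsub => signRegion_maximal hl hV ht hsub

end SignRegion

/-! ### Classification of the maxtame subsets of the circle -/

/-- A preconnected set of reals is an interval, so its closure adds at most the two endpoints. -/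
lemma finite_closure_sdiff_of_isPreconnected_real {I : Set ℝ} (hI : IsPreconnected I) :
    (closure I \ I).Finite := by
  have hsub : closure I \ I ⊆ {sInf I, sSup I} := by
    rcases hI.mem_intervals with h | h | h | h | h | h | h | h | h | h <;>
    · generalize sInf I = a at *
      generalize sSup I = b at *
      rw [h]
      intro x hx
      first
      | (simp at hx; done)
      | (by_cases hab : a = b
         · subst hab; simp at hx
         · simp [closure_Ioo, closure_Ioc, closure_Ico, hab] at hx ⊢
           by_contra! hne
           grind)
      | (simp at hx ⊢
         grind)
  exact (Set.toFinite _).subset hsub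

/-- Stereographic projection from `-a` with `a ∈ C` is defined on `C`, since `C` has no antipodal
pair, and reduces the claim to intervals; only `-a` itself has to be added. -/
lemma finite_closure_sdiff_of_isPreconnected {C : Set Circ} (hC : IsPreconnected C)
    (ht : ∀ x ∈ C, -x ∉ C) : (closure C \ C).Finite := by
  rcases C.eq_empty_or_nonempty with rfl | ⟨a, ha⟩
  · simp
  let s : Circ → ℝ := fun x => wedge a x / (1 + dotp a x)
  -- The half-angle parametrisation, which inverts the projection `s` away from `-a`.
  have hσ : ∀ t : ℝ, ((1 - t ^ 2) / (1 + t ^ 2) * a.1 0 - 2 * t / (1 + t ^ 2) * a.1 1) ^ 2 +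
      ((1 - t ^ 2) / (1 + t ^ 2) * a.1 1 + 2 * t / (1 + t ^ 2) * a.1 0) ^ 2 = 1 := by
    intro t
    have h := sq_add_sq a
    have h2 : 1 + t ^ 2 ≠ 0 := by positivity
    field_simp
    linear_combination (1 + t ^ 2) ^ 2 * h
  let σ : ℝ → Circ := fun t => mk _ _ (hσ t)
  have hne : ∀ x : Circ, x ≠ -a → 1 + dotp a x ≠ 0 := by
    intro x hx h
    have h1 := dotp_sq_add_wedge_sq a x
    have h2 : dotp a x = -1 := by linarith
    rw [h2] at h1
    have h3 : wedge a x = 0 := by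
      have : wedge a x ^ 2 = 0 := by linarith
      exact pow_eq_zero_iff (two_ne_zero) |>.mp this
    rcases wedge_eq_zero_iff.mp h3 with rfl | h4
    · rw [dotp_self] at h2; norm_num at h2
    · exact hx h4
  have hinv : ∀ x : Circ, x ≠ -a → σ (s x) = x := by
    intro x hx
    have h0 := hne x hx
    have h1 := dotp_sq_add_wedge_sq a x
    have h3 : 1 + s x ^ 2 = 2 / (1 + dotp a x) := by
      simp only [s]; field_simp; linear_combination h1
    have h4 : (1 - s x ^ 2) / (1 + s x ^ 2) = dotp a x := by
      rw [h3]; simp only [s]; field_simp; linear_combination -h1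
    have h5 : 2 * s x / (1 + s x ^ 2) = wedge a x := by
      rw [h3]; simp only [s]; field_simp
    apply ext_coords
    · rw [mk_zero, h4, h5, ← coord_zero_eq]
    · rw [mk_one, h4, h5, ← coord_one_eq]
  have hs : ∀ x : Circ, x ≠ -a → ContinuousAt s x := fun x hx =>
    (continuous_wedge_right a).continuousAt.div
      (continuous_const.add (continuous_dotp_right a)).continuousAt (hne x hx)
  have hCa : ∀ x ∈ C, x ≠ -a := by
    rintro x hx rfl
    exact ht a ha hx
  have hI : IsPreconnected (s '' C) :=
    hC.image s fun x hx => (hs x (hCa x hx)).continuousWithinAt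
  refine (((finite_closure_sdiff_of_isPreconnected_real hI).image σ).insert (-a)).subset ?_
  rintro x ⟨hx, hxC⟩
  by_cases hxa : x = -a
  · exact Or.inl hxa
  · refine Or.inr ⟨s x, ⟨?_, ?_⟩, hinv x hxa⟩
    · exact (hs x hxa).continuousWithinAt.mem_closure_image hx
    · rintro ⟨y, hy, hyx⟩
      rw [← hinv x hxa, ← hyx, hinv y (hCa y hy)] at hxC
      exact hxC hy

namespace IsMaxtame

variable {U : Set Circ}

lemma isOpen (hU : IsMaxtame U) : IsOpen U := hU.weakly.isOpen

lemma neg_notMem (hU : IsMaxtame U) {x : Circ} (hx : x ∈ U) : -x ∉ U :=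
  (isTame_two_iff U).mp hU.weakly.tame x hx

/-- Otherwise a neighbourhood of `x` inside an open half circle, avoiding the closures of `U` and
`-U`, could be added to `U` without creating an antipodal pair. -/
lemma closure_union (hU : IsMaxtame U) (x : Circ) : x ∈ closure U ∨ -x ∈ closure U := by
  by_contra! hx
  have hO : IsOpen ({y | y ∉ closure U} ∩ {y | -y ∉ closure U} ∩ {y | 0 < dotp x y}) := by
    refine (IsOpen.inter isClosed_closure.isOpen_compl ?_).inter
      (isOpen_lt continuous_const (continuous_dotp_right x))
    exact isClosed_closure.isOpen_compl.preimage (continuous_neg (G := Circ))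
  set O := {y | y ∉ closure U} ∩ {y | -y ∉ closure U} ∩ {y | 0 < dotp x y} with hOdef
  have hxO : x ∈ O := ⟨hx, by rw [Set.mem_ofPred_eq, dotp_self]; exact one_pos⟩
  have ht : IsTame 2 (U ∪ O) := by
    rw [isTame_two_iff]
    rintro y (hy | hy) (hy' | hy')
    · exact hU.neg_notMem hy hy'
    · apply hy'.1.2
      rw [neg_neg]
      exact subset_closure hy
    · exact hy.1.2 (subset_closure hy')
    · have h1 : 0 < dotp x y := hy.2
      have h2 : 0 < dotp x (-y) := hy'.2
      rw [dotp_neg_right] at h2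
      linarith
  have := hU.maximal _ (hU.isOpen.union hO) ht Set.subset_union_left
  have hxU : x ∈ U := this ▸ Or.inr hxO
  exact hx.1 (subset_closure hxU)

lemma finite_closure_sdiff (hU : IsMaxtame U) : (closure U \ U).Finite := by
  have hfin : Finite (ConnectedComponents U) := ENat.card_lt_top.mp hU.weakly.finite_components
  let C : ConnectedComponents U → Set Circ := fun c =>
    Subtype.val '' (ConnectedComponents.mk ⁻¹' {c} : Set U)
  have hCU : ∀ c, C c ⊆ U := by
    rintro c _ ⟨x, -, rfl⟩
    exact x.2
  have hC : ∀ c, IsPreconnected (C c) := by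
    intro c
    obtain ⟨x, rfl⟩ := ConnectedComponents.surjective_coe c
    simp only [C]
    rw [connectedComponents_preimage_singleton]
    exact isPreconnected_connectedComponent.image _ continuous_subtype_val.continuousOn
  have hUC : U = ⋃ c, C c := by
    apply subset_antisymm
    · intro x hx
      exact Set.mem_iUnion.mpr ⟨ConnectedComponents.mk ⟨x, hx⟩, ⟨x, hx⟩, rfl, rfl⟩
    · exact Set.iUnion_subset hCU
  have hcl : closure U = ⋃ c, closure (C c) := by
    conv_lhs => rw [hUC]
    exact closure_iUnion_of_finite (f := C)
  have hsub : closure U \ U ⊆ ⋃ c, closure (C c) \ C c := by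
    rintro x ⟨hx, hxU⟩
    rw [hcl] at hx
    obtain ⟨c, hc⟩ := Set.mem_iUnion.mp hx
    exact Set.mem_iUnion.mpr ⟨c, hc, fun h => hxU (hCU c h)⟩
  exact (Set.finite_iUnion fun c => finite_closure_sdiff_of_isPreconnected (hC c)
    fun x hx hx' => hU.neg_notMem (hCU c hx) (hCU c hx')).subset hsub

/-- Passing to the interior of the closure keeps tameness: an antipodal pair there could be moved,
by density of `U`, to an antipodal pair in `U`. Maximality then applies. -/
lemma interior_closure (hU : IsMaxtame U) : interior (closure U) = U := by
  refine hU.maximal _ isOpen_interior ?_ (interior_maximal subset_closure hU.isOpen)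
  rw [isTame_two_iff]
  intro x hx hx'
  have hO : IsOpen (interior (closure U) ∩ (fun y => -y) ⁻¹' interior (closure U)) :=
    isOpen_interior.inter (isOpen_interior.preimage continuous_neg)
  obtain ⟨y, ⟨hy1, hy2⟩, hyU⟩ :=
    mem_closure_iff.mp (interior_subset hx) _ hO ⟨hx, hx'⟩
  have hy3 : -y ∈ closure U := interior_subset hy2
  obtain ⟨u, hu1, hu2⟩ := mem_closure_iff.mp hy3 ((fun y => -y) ⁻¹' U)
    (hU.isOpen.preimage continuous_neg) (by simpa using hyU)
  exact hU.neg_notMem hu2 hu1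

/-- If `x` is outside `closure U`, then `-x` has a neighbourhood whose antipode misses `closure U`.
By `closure_union` that neighbourhood lies in `closure U`, so `-x` lies in its interior, which is
`U`. -/
lemma frontier_eq (hU : IsMaxtame U) : frontier U = {x | x ∉ U ∧ -x ∉ U} := by
  rw [hU.isOpen.frontier_eq]
  ext x
  constructor
  · rintro ⟨hx, hxU⟩
    refine ⟨hxU, fun h => ?_⟩
    obtain ⟨u, hu1, hu2⟩ := mem_closure_iff.mp hx ((fun y => -y) ⁻¹' U)
      (hU.isOpen.preimage continuous_neg) h
    exact hU.neg_notMem hu2 hu1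
  · rintro ⟨hx, hx'⟩
    refine ⟨?_, hx⟩
    by_contra hxc
    apply hx'
    rw [← hU.interior_closure]
    have hO : IsOpen {y : Circ | -y ∉ closure U} :=
      isClosed_closure.isOpen_compl.preimage (continuous_neg (G := Circ))
    refine interior_maximal ?_ hO (by simpa using hxc)
    intro y hy
    rcases hU.closure_union y with h | h
    · exact h
    · exact absurd h hy

lemma finite_frontier (hU : IsMaxtame U) : (frontier U).Finite := by
  rw [hU.isOpen.frontier_eq]
  exact hU.finite_closure_sdiff

lemma mem_of_punctured_nhd (hU : IsMaxtame U) {N : Set Circ} (hN : IsOpen N) {z : Circ}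
    (hz : z ∈ N) (h : ∀ x ∈ N, x ≠ z → x ∈ U) : z ∈ U := by
  rw [← hU.interior_closure]
  refine interior_maximal ?_ hN hz
  intro y hy
  rw [mem_closure_iff]
  intro O hO hyO
  obtain ⟨x, ⟨hx1, hx2⟩, hx3⟩ := inter_nonempty_of_finite_compl (s := {z}ᶜ) (by simp)
    (hO.inter hN) ⟨y, hyO, hy⟩
  exact ⟨x, hx1, h x hx2 hx3⟩

open Classical in
/-- The function with value `1` on `U`, `-1` on its antipodal set and `0` elsewhere. -/
noncomputable def _root_.antipodalSign (U : Set Circ) (x : Circ) : ℝ :=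
  if x ∈ U then 1 else if -x ∈ U then -1 else 0

lemma antipodalSign_of_mem {x : Circ} (hx : x ∈ U) : antipodalSign U x = 1 := if_pos hx

lemma antipodalSign_of_neg_mem (hU : IsMaxtame U) {x : Circ} (hx : -x ∈ U) :
    antipodalSign U x = -1 := by
  have : x ∉ U := fun h => hU.neg_notMem h hx
  rw [antipodalSign, if_neg this, if_pos hx]

lemma antipodalSign_neg (hU : IsMaxtame U) (x : Circ) :
    antipodalSign U (-x) = -antipodalSign U x := by
  by_cases h1 : x ∈ U
  · rw [antipodalSign_of_mem h1, hU.antipodalSign_of_neg_mem (by rwa [neg_neg])]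
  by_cases h2 : -x ∈ U
  · rw [antipodalSign_of_mem h2, hU.antipodalSign_of_neg_mem h2, neg_neg]
  · simp [antipodalSign, h1, h2]

/-- Near a boundary point `z` the sign function of `U` is a multiple of that of `det (z, x)`. -/
lemma exists_sign_near (hU : IsMaxtame U) {l : ℕ} (w : Fin l → Circ)
    (hw : ∀ x, x ∈ frontier U ↔ wedgeProd w x = 0) {z : Circ} (hz : z ∈ frontier U) :
    ∃ c : ℝ, ∀ x ∈ lineNhd w z, wedgeProd w x ≠ 0 → 0 < c * antipodalSign U x * wedge z x := by
  have hzU : z ∉ U ∧ -z ∉ U := by rwa [hU.frontier_eq] at hz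
  have hpz : ∀ x ∈ lineNhd w z, wedge z x = 0 → x = z := fun x hx h =>
    eq_of_wedge_eq_zero_of_dotp_pos h hx.1
  have hne : ∀ x ∈ lineNhd w z, x ≠ z → wedgeProd w x ≠ 0 := by
    intro x hx hxz h
    obtain ⟨j, hj⟩ := Finset.prod_eq_zero_iff.mp h
    rcases eq_or_ne (wedge (w j) z) 0 with h0 | h0
    · rcases wedge_eq_zero_iff.mp h0 with h1 | h1
      · apply hxz; apply hpz x hx; rw [h1]; exact hj.2
      · apply hxz; apply hpz x hx; rw [h1, wedge_neg_left, hj.2, neg_zero]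
    · have := hx.2 j h0
      rw [hj.2, mul_zero] at this
      exact this.false
  have hcov : ∀ x ∈ lineNhd w z, x ≠ z → x ∈ U ∨ -x ∈ U := by
    intro x hx hxz
    have h := hne x hx hxz
    rw [ne_eq, ← hw x, hU.frontier_eq, Set.mem_ofPred_eq] at h
    tauto
  -- Each side of `z` in `lineNhd` is connected and free of frontier points, so it lies wholly in
  -- `U` or wholly in `-U`.
  have hside : ∀ ε : ℝ, lineNhd w z ∩ {x | 0 < ε * wedge z x} ⊆ U ∨
      lineNhd w z ∩ {x | 0 < ε * wedge z x} ⊆ (fun x => -x) ⁻¹' U := by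
    intro ε
    refine (isPreconnected_lineNhd_side w z ε).subset_or_subset hU.isOpen
      (hU.isOpen.preimage continuous_neg) ?_ ?_
    · rw [Set.disjoint_left]
      exact fun x hx hx' => hU.neg_notMem hx hx'
    · rintro x ⟨hx, hx'⟩
      refine hcov x hx ?_
      rintro rfl
      rw [Set.mem_ofPred_eq, wedge_self, mul_zero] at hx'
      exact hx'.false
  have hsplit : ∀ x ∈ lineNhd w z, x ≠ z → 0 < 1 * wedge z x ∨ 0 < (-1) * wedge z x := by
    intro x hx hxz
    rcases lt_trichotomy (wedge z x) 0 with h | h | h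
    · right; linarith
    · exact absurd (hpz x hx h) hxz
    · left; linarith
  have hxz : ∀ x, wedgeProd w x ≠ 0 → x ≠ z := by
    rintro x hx rfl
    exact hx ((hw x).mp hz)
  -- If both sides lay in `U`, or both in `-U`, regularity would put `z` or `-z` into `U`; so the
  -- sign changes at `z`, and `c` records its direction.
  rcases hside 1 with h1 | h1 <;> rcases hside (-1) with h2 | h2
  · exfalso
    refine hzU.1 (hU.mem_of_punctured_nhd (isOpen_lineNhd w z) (self_mem_lineNhd w z) ?_)
    intro x hx hxz
    rcases hsplit x hx hxz with h | h
    · exact h1 ⟨hx, h⟩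
    · exact h2 ⟨hx, h⟩
  · refine ⟨1, fun x hx hp => ?_⟩
    rcases hsplit x hx (hxz x hp) with h | h
    · rw [antipodalSign_of_mem (h1 ⟨hx, h⟩)]; linarith
    · rw [hU.antipodalSign_of_neg_mem (h2 ⟨hx, h⟩)]; linarith
  · refine ⟨-1, fun x hx hp => ?_⟩
    rcases hsplit x hx (hxz x hp) with h | h
    · rw [hU.antipodalSign_of_neg_mem (h1 ⟨hx, h⟩)]; linarith
    · rw [antipodalSign_of_mem (h2 ⟨hx, h⟩)]; linarith
  · exfalso
    refine hzU.2 (hU.mem_of_punctured_nhd (N := (fun x => -x) ⁻¹' lineNhd w z)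
      ((isOpen_lineNhd w z).preimage continuous_neg) (by simpa using self_mem_lineNhd w z) ?_)
    intro x hx hxz
    have hxz' : -x ≠ z := fun h => hxz (by rw [← h, neg_neg])
    rcases hsplit (-x) hx hxz' with h | h
    · simpa using h1 ⟨hx, h⟩
    · simpa using h2 ⟨hx, h⟩

/-- If `w` enumerates the boundary points of the maxtame set `U`, one from each antipodal pair,
then the sign function of `U` is that of `∏ det (w_j, x)` up to a global sign. -/
lemma exists_sign (hU : IsMaxtame U) {l : ℕ} (w : Fin l → Circ)
    (hw : ∀ x, x ∈ frontier U ↔ wedgeProd w x = 0)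
    (hinj : ∀ i j, wedge (w i) (w j) = 0 → i = j) :
    ∃ ε : ℝ, (ε = 1 ∨ ε = -1) ∧
      ∀ x, wedgeProd w x ≠ 0 → 0 < ε * (antipodalSign U x * wedgeProd w x) := by
  have hcov : ∀ x, wedgeProd w x ≠ 0 → x ∈ U ∨ -x ∈ U := by
    intro x h
    rw [ne_eq, ← hw x, hU.frontier_eq, Set.mem_ofPred_eq] at h
    tauto
  have hlocal : ∀ z, ∃ N, IsOpen N ∧ z ∈ N ∧ ∃ c : ℝ, c ≠ 0 ∧
      ∀ x ∈ N, wedgeProd w x ≠ 0 → 0 < c * (antipodalSign U x * wedgeProd w x) := by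
    intro z
    by_cases hz : wedgeProd w z = 0
    · obtain ⟨c, hc⟩ := hU.exists_sign_near w hw ((hw z).mpr hz)
      obtain ⟨j, hj⟩ := (wedgeProd_eq_zero_iff w z).mp hz
      obtain ⟨η, hη, hηw⟩ : ∃ η : ℝ, η * η = 1 ∧ ∀ x, wedge (w j) x = η * wedge z x := by
        rcases hj with rfl | rfl
        · exact ⟨1, by norm_num, fun x => by ring⟩
        · exact ⟨-1, by norm_num, fun x => by rw [wedge_neg_left]; ring⟩
      let q : Circ → ℝ := fun x => ∏ i ∈ Finset.univ.erase j, wedge (w i) x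
      have hpq : ∀ x, wedgeProd w x = η * wedge z x * q x := by
        intro x
        rw [wedgeProd, ← Finset.mul_prod_erase _ _ (Finset.mem_univ j), hηw]
      -- By `hinj` the factor `j` is the only one that vanishes at `z`; the others keep their signs
      -- on `lineNhd`.
      have hq : ∀ x ∈ lineNhd w z, 0 < q z * q x := by
        intro x hx
        simp only [q]
        rw [← Finset.prod_mul_distrib]
        refine Finset.prod_pos fun i hi => hx.2 i fun h0 => ?_
        refine Finset.ne_of_mem_erase hi (hinj i j ?_)
        rcases hj with rfl | rfl
        · exact h0
        · rwa [wedge_neg_right, neg_eq_zero] at h0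
      have hmain : ∀ x ∈ lineNhd w z, wedgeProd w x ≠ 0 →
          0 < c * η * q z * (antipodalSign U x * wedgeProd w x) := by
        intro x hx hp
        have := mul_pos (hc x hx hp) (hq x hx)
        rw [hpq]
        calc 0 < _ := this
          _ = (η * η) * (c * antipodalSign U x * wedge z x * (q z * q x)) := by rw [hη, one_mul]
          _ = _ := by ring
      refine ⟨lineNhd w z, isOpen_lineNhd w z, self_mem_lineNhd w z, c * η * q z, ?_, hmain⟩
      intro h0
      obtain ⟨x, hx1, hx2⟩ := inter_nonempty_of_finite_compl (finite_compl_wedgeProd_ne w)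
        (isOpen_lineNhd w z) ⟨z, self_mem_lineNhd w z⟩
      have := hmain x hx1 hx2
      rw [h0, zero_mul] at this
      exact this.false
    · rcases hcov z hz with h | h
      · refine ⟨U ∩ {x | 0 < wedgeProd w z * wedgeProd w x}, hU.isOpen.inter
          (isOpen_lt continuous_const (continuous_const.mul (continuous_wedgeProd w))),
          ⟨h, mul_self_pos.mpr hz⟩, wedgeProd w z, hz, ?_⟩
        rintro x ⟨hx1, hx2⟩ -
        rw [antipodalSign_of_mem hx1, one_mul]
        exact hx2
      · refine ⟨(fun x => -x) ⁻¹' U ∩ {x | 0 < wedgeProd w z * wedgeProd w x},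
          (hU.isOpen.preimage continuous_neg).inter
          (isOpen_lt continuous_const (continuous_const.mul (continuous_wedgeProd w))),
          ⟨h, mul_self_pos.mpr hz⟩, -wedgeProd w z, neg_ne_zero.mpr hz, ?_⟩
        rintro x ⟨hx1, hx2⟩ -
        rw [hU.antipodalSign_of_neg_mem hx1]
        have : 0 < wedgeProd w z * wedgeProd w x := hx2
        linarith
  -- The local signs are glued by connectedness: `A 1` and `A (-1)` are open, cover the circle and
  -- are disjoint, since overlapping neighbourhoods share points off the zeros.
  let A : ℝ → Set Circ := fun ε => {z | ∃ N, IsOpen N ∧ z ∈ N ∧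
    ∀ x ∈ N, wedgeProd w x ≠ 0 → 0 < ε * (antipodalSign U x * wedgeProd w x)}
  have hA : ∀ ε, IsOpen (A ε) := by
    intro ε
    rw [isOpen_iff_forall_mem_open]
    rintro z ⟨N, hN, hzN, h⟩
    exact ⟨N, fun y hy => ⟨N, hN, hy, h⟩, hN, hzN⟩
  have hcovA : Set.univ ⊆ A 1 ∪ A (-1) := by
    intro z _
    obtain ⟨N, hN, hzN, c, hc, h⟩ := hlocal z
    rcases hc.lt_or_gt with hc | hc
    · refine Or.inr ⟨N, hN, hzN, fun x hx hp => ?_⟩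
      have := neg_of_mul_pos_right (h x hx hp) hc.le
      linarith
    · refine Or.inl ⟨N, hN, hzN, fun x hx hp => ?_⟩
      have := (mul_pos_iff_of_pos_left hc).mp (h x hx hp)
      linarith
  have hdisj : Disjoint (A 1) (A (-1)) := by
    rw [Set.disjoint_left]
    rintro z ⟨N, hN, hzN, h⟩ ⟨N', hN', hzN', h'⟩
    obtain ⟨x, ⟨hx1, hx2⟩, hx3⟩ := inter_nonempty_of_finite_compl (finite_compl_wedgeProd_ne w)
      (hN.inter hN') ⟨z, hzN, hzN'⟩
    have := h x hx1 hx3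
    have := h' x hx2 hx3
    linarith
  rcases isPreconnected_univ.subset_or_subset (hA 1) (hA (-1)) hdisj hcovA with h | h
  · refine ⟨1, Or.inl rfl, fun x hx => ?_⟩
    obtain ⟨N, -, hxN, hN⟩ := h (Set.mem_univ x)
    exact hN x hxN hx
  · refine ⟨-1, Or.inr rfl, fun x hx => ?_⟩
    obtain ⟨N, -, hxN, hN⟩ := h (Set.mem_univ x)
    exact hN x hxN hx

theorem classification (hU : IsMaxtame U) {l : ℕ} (w : Fin l → Circ)
    (hw : ∀ x, x ∈ frontier U ↔ wedgeProd w x = 0)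
    (hinj : ∀ i j, wedge (w i) (w j) = 0 → i = j) :
    Odd l ∧ (U = {x | 0 < wedgeProd w x} ∨ U = {x | wedgeProd w x < 0}) := by
  obtain ⟨ε, hε, h⟩ := hU.exists_sign w hw hinj
  have hmem : ∀ x, wedgeProd w x ≠ 0 ↔ (x ∈ U ∨ -x ∈ U) := by
    intro x
    rw [ne_eq, ← hw x, hU.frontier_eq, Set.mem_ofPred_eq]
    tauto
  refine ⟨?_, ?_⟩
  -- For even `l` the product is even while `antipodalSign` is odd, so their product could not have
  -- constant sign.
  · by_contra hl
    rw [Nat.not_odd_iff_even] at hl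
    obtain ⟨x, -, hx⟩ := inter_nonempty_of_finite_compl (finite_compl_wedgeProd_ne w)
      isOpen_univ Set.univ_nonempty
    have h1 := h x hx
    have h2 := h (-x) (by rwa [wedgeProd_neg_right, hl.neg_one_pow, one_mul])
    rw [wedgeProd_neg_right, hl.neg_one_pow, hU.antipodalSign_neg] at h2
    linarith
  · have hUε : U = {x | 0 < ε * wedgeProd w x} := by
      ext x
      constructor
      · intro hx
        have := h x ((hmem x).mpr (Or.inl hx))
        rwa [antipodalSign_of_mem hx, one_mul] at this
      · intro hx
        have hx' : 0 < ε * wedgeProd w x := hx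
        have hp : wedgeProd w x ≠ 0 := fun h0 => by rw [h0, mul_zero] at hx'; exact hx'.false
        rcases (hmem x).mp hp with h1 | h1
        · exact h1
        · have := h x hp
          rw [hU.antipodalSign_of_neg_mem h1] at this
          linarith
    rcases hε with rfl | rfl
    · left; simpa using hUε
    · right; simpa using hUε

end IsMaxtame

/-! ### Boundaries of maxtame sets -/

lemma toRPLine_eq_iff {x y : Circ} : toRPLine x = toRPLine y ↔ x = y ∨ x = -y :=
  Quotient.eq (r := antipodalSetoid)

lemma toRPLine_eq_iff_wedge {x y : Circ} : toRPLine x = toRPLine y ↔ wedge x y = 0 := by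
  rw [eq_comm, toRPLine_eq_iff, wedge_eq_zero_iff]

lemma toRPLine_neg (x : Circ) : toRPLine (-x) = toRPLine x := toRPLine_eq_iff.mpr (Or.inr rfl)

lemma toRPLine_surjective : Function.Surjective toRPLine := Quotient.mk_surjective

lemma mem_oddPart_iff {l : ℕ} (x : Fin l → RPLine) (p : RPLine) [DecidableEq RPLine] :
    p ∈ oddPart x ↔ Odd (Finset.univ.filter fun i => x i = p).card := by
  classical
  have : oddPart x = (Finset.univ.image x).filter
      fun p => Odd (Finset.univ.filter fun i => x i = p).card := by
    unfold oddPart; congr!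
  rw [this, Finset.mem_filter, and_iff_right_iff_imp]
  intro h
  obtain ⟨i, hi⟩ := Finset.card_pos.mp h.pos
  exact Finset.mem_image.mpr ⟨i, Finset.mem_univ i, (Finset.mem_filter.mp hi).2⟩

open Classical in
/-- Near `z` the product of the `det (v_j, x)` behaves like a power of `det (z, x)`. -/
lemma exists_wedgeProd_near {l : ℕ} (v : Fin l → Circ) (z : Circ) :
    ∃ c : ℝ, c ≠ 0 ∧ ∀ x ∈ lineNhd v z, ∃ r : ℝ, 0 < r ∧
      c * wedgeProd v x =
        r * wedge z x ^ (Finset.univ.filter fun i => toRPLine (v i) = toRPLine z).card := by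
  set J := Finset.univ.filter fun i => toRPLine (v i) = toRPLine z with hJ
  have hmemJ : ∀ i, i ∈ J ↔ wedge (v i) z = 0 := by
    intro i
    rw [hJ, Finset.mem_filter, toRPLine_eq_iff_wedge]
    simp
  have hη : ∀ i ∈ J, ∃ η : ℝ, η * η = 1 ∧ ∀ x, wedge (v i) x = η * wedge z x := by
    intro i hi
    rcases wedge_eq_zero_iff.mp ((hmemJ i).mp hi) with h | h
    · exact ⟨1, by norm_num, fun x => by rw [h, one_mul]⟩
    · exact ⟨-1, by norm_num, fun x => by rw [h, wedge_neg_left]; ring⟩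
  choose! η hη1 hη2 using hη
  -- The factors not vanishing at `z` keep their signs on `lineNhd`; each of the others is `±det (z,
  -- x)`.
  let q : Circ → ℝ := fun x => ∏ i ∈ Jᶜ, wedge (v i) x
  have hqz : q z ≠ 0 := Finset.prod_ne_zero_iff.mpr fun i hi => by
    rwa [Finset.mem_compl, hmemJ] at hi
  have hK : (∏ i ∈ J, η i) * ∏ i ∈ J, η i = 1 := by
    rw [← Finset.prod_mul_distrib]
    exact Finset.prod_eq_one hη1
  refine ⟨(∏ i ∈ J, η i) * q z, mul_ne_zero (fun h => by simp [h] at hK) hqz, fun x hx => ?_⟩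
  refine ⟨q z * q x, ?_, ?_⟩
  · simp only [q]
    rw [← Finset.prod_mul_distrib]
    refine Finset.prod_pos fun i hi => hx.2 i ?_
    rwa [Finset.mem_compl, hmemJ] at hi
  · have : wedgeProd v x = (∏ i ∈ J, η i) * wedge z x ^ J.card * q x := by
      rw [wedgeProd, ← Finset.prod_mul_prod_compl J, Finset.prod_congr rfl fun i hi => hη2 i hi x,
        Finset.prod_mul_distrib, Finset.prod_const]
    rw [this]
    calc _ = ((∏ i ∈ J, η i) * ∏ i ∈ J, η i) * (q z * q x * wedge z x ^ J.card) := by ring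
      _ = _ := by rw [hK, one_mul]

/-- The boundary points of `U_v` are the lines that occur an odd number of times in `v`. -/
lemma frontier_signRegion {l : ℕ} (hl : Odd l) (v : Fin l → Circ) :
    frontier (signRegion v) = toRPLine ⁻¹' (oddPart fun i => toRPLine (v i) : Set RPLine) := by
  classical
  ext z
  rw [(isMaxtame_signRegion hl v).frontier_eq, Set.mem_preimage, Finset.mem_coe,
    mem_oddPart_iff, Set.mem_ofPred_eq]
  obtain ⟨c, hc0, hc⟩ := exists_wedgeProd_near v z
  set k := (Finset.univ.filter fun i => toRPLine (v i) = toRPLine z).card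
  have hpn : ∀ x, wedgeProd v (-x) = -wedgeProd v x := fun x => by
    rw [wedgeProd_neg_right, hl.neg_one_pow]; ring
  constructor
  · rintro ⟨h1, h2⟩
    by_contra hk
    rw [Nat.not_odd_iff_even] at hk
    -- At even multiplicity the product does not change sign at `z`, so `z` or `-z` is interior to
    -- the region, according to the sign of `c`.
    have hnn : ∀ x ∈ lineNhd v z, 0 ≤ c * wedgeProd v x := by
      intro x hx
      obtain ⟨r, hr, h⟩ := hc x hx
      rw [h]
      exact mul_nonneg hr.le (hk.pow_nonneg _)
    rcases hc0.lt_or_gt with hneg | hpos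
    · apply h2
      refine subset_signRegion v (V := (fun x => -x) ⁻¹' lineNhd v z)
        ((isOpen_lineNhd v z).preimage continuous_neg) ?_ (by simpa using self_mem_lineNhd v z)
      intro x hx
      have := hnn (-x) hx
      rw [hpn] at this
      nlinarith
    · apply h1
      refine subset_signRegion v (isOpen_lineNhd v z) ?_ (self_mem_lineNhd v z)
      intro x hx
      exact nonneg_of_mul_nonneg_right (hnn x hx) hpos
  · intro hk
    -- At odd multiplicity both signs occur arbitrarily close to `z`, which excludes `z` and `-z`
    -- from the region.
    have hside : ∀ O : Set Circ, IsOpen O → z ∈ O →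
        (∃ x ∈ O, 0 < c * wedgeProd v x) ∧ ∃ x ∈ O, c * wedgeProd v x < 0 := by
      intro O hO hz
      have hON := hO.inter (isOpen_lineNhd v z)
      constructor
      · obtain ⟨x, ⟨hx1, hx2⟩, hx3⟩ := mem_closure_iff.mp
          (mem_closure_wedge_side z (Or.inl rfl)) _ hON ⟨hz, self_mem_lineNhd v z⟩
        rw [Set.mem_ofPred_eq, one_mul] at hx3
        obtain ⟨r, hr, h⟩ := hc x hx2
        exact ⟨x, hx1, by rw [h]; exact mul_pos hr (pow_pos hx3 k)⟩
      · obtain ⟨x, ⟨hx1, hx2⟩, hx3⟩ := mem_closure_iff.mp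
          (mem_closure_wedge_side z (Or.inr rfl)) _ hON ⟨hz, self_mem_lineNhd v z⟩
        rw [Set.mem_ofPred_eq, neg_one_mul, neg_pos] at hx3
        obtain ⟨r, hr, h⟩ := hc x hx2
        exact ⟨x, hx1, by rw [h]; exact mul_neg_of_pos_of_neg hr (hk.pow_neg hx3)⟩
    constructor
    · intro hz
      obtain ⟨⟨x, hx, hx'⟩, y, hy, hy'⟩ := hside _ (isOpen_signRegion v) hz
      have h1 := nonneg_of_mem_signRegion v hx
      have h2 := nonneg_of_mem_signRegion v hy
      have h3 : 0 < c := by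
        by_contra! h
        nlinarith
      nlinarith
    · intro hz
      obtain ⟨⟨x, hx, hx'⟩, y, hy, hy'⟩ := hside _
        ((isOpen_signRegion v).preimage continuous_neg) hz
      have h1 := nonneg_of_mem_signRegion v hx
      have h2 := nonneg_of_mem_signRegion v hy
      rw [hpn] at h1 h2
      have h3 : c < 0 := by
        by_contra! h
        nlinarith
      nlinarith

lemma signRegion_neg {l : ℕ} (v : Fin l → Circ) :
    signRegion (-v) = (fun x => -x) ⁻¹' signRegion v := by
  rw [signRegion_eq, signRegion_eq]
  have h : {z | 0 < wedgeProd (-v) z} = Homeomorph.neg Circ ⁻¹' {z | 0 < wedgeProd v z} := by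
    ext z
    simp [wedgeProd_neg_left, wedgeProd_neg_right]
  rw [h, ← Homeomorph.preimage_closure, ← Homeomorph.preimage_interior]
  rfl

/-- Representatives on the circle of the points of a configuration. -/
noncomputable def repTuple (F : Finset RPLine) (i : Fin F.card) : Circ :=
  (F.equivFin.symm i).1.out

lemma toRPLine_repTuple (F : Finset RPLine) (i : Fin F.card) :
    toRPLine (repTuple F i) = (F.equivFin.symm i).1 := Quotient.out_eq _

lemma wedgeProd_repTuple_eq_zero_iff (F : Finset RPLine) (x : Circ) :
    wedgeProd (repTuple F) x = 0 ↔ toRPLine x ∈ F := by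
  rw [wedgeProd, Finset.prod_eq_zero_iff]
  constructor
  · rintro ⟨i, -, hi⟩
    rw [← toRPLine_eq_iff_wedge.mpr hi, toRPLine_repTuple]
    exact (F.equivFin.symm i).2
  · intro h
    refine ⟨F.equivFin ⟨toRPLine x, h⟩, Finset.mem_univ _, ?_⟩
    rw [← toRPLine_eq_iff_wedge, toRPLine_repTuple, Equiv.symm_apply_apply]

lemma repTuple_injective (F : Finset RPLine) (i j : Fin F.card)
    (h : wedge (repTuple F i) (repTuple F j) = 0) : i = j := by
  rw [← toRPLine_eq_iff_wedge, toRPLine_repTuple, toRPLine_repTuple] at h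
  exact F.equivFin.symm.injective (Subtype.ext h)

lemma oddPart_repTuple (F : Finset RPLine) : oddPart (fun i => toRPLine (repTuple F i)) = F := by
  classical
  ext p
  rw [mem_oddPart_iff]
  by_cases hp : p ∈ F
  · have : (Finset.univ.filter fun i => toRPLine (repTuple F i) = p) = {F.equivFin ⟨p, hp⟩} := by
      ext i
      rw [Finset.mem_filter, toRPLine_repTuple, Finset.mem_singleton, ← Equiv.symm_apply_eq,
        Subtype.ext_iff]
      simp
    simp [this, hp]
  · have : (Finset.univ.filter fun i => toRPLine (repTuple F i) = p) = ∅ := by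
      rw [Finset.filter_eq_empty_iff]
      rintro i - rfl
      rw [toRPLine_repTuple] at hp
      exact hp (F.equivFin.symm i).2
    simp [this, hp]

namespace IsMaxtame

variable {U : Set Circ}

theorem eq_signRegion_repTuple (hU : IsMaxtame U) {F : Finset RPLine}
    (hF : frontier U = toRPLine ⁻¹' (F : Set RPLine)) :
    Odd F.card ∧ (U = signRegion (repTuple F) ∨ U = signRegion (-repTuple F)) := by
  obtain ⟨hodd, h⟩ := hU.classification (repTuple F)
    (fun x => by rw [wedgeProd_repTuple_eq_zero_iff, hF]; rfl) (repTuple_injective F)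
  refine ⟨hodd, h.imp (fun h => ?_) fun h => ?_⟩
  · rw [signRegion_eq, ← h, hU.interior_closure]
  · have : {x | wedgeProd (repTuple F) x < 0} = {x | 0 < wedgeProd (-repTuple F) x} := by
      ext x
      simp [wedgeProd_neg_left, hodd.neg_one_pow]
    rw [signRegion_eq, ← this, ← h, hU.interior_closure]

theorem exists_frontier_eq (hU : IsMaxtame U) :
    ∃ F : Finset RPLine, frontier U = toRPLine ⁻¹' (F : Set RPLine) := by
  refine ⟨(hU.finite_frontier.image toRPLine).toFinset, ?_⟩
  rw [Set.Finite.coe_toFinset]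
  refine subset_antisymm (Set.subset_preimage_image _ _) ?_
  rintro x ⟨y, hy, hyx⟩
  rcases toRPLine_eq_iff.mp hyx with rfl | rfl
  · exact hy
  · rw [hU.frontier_eq] at hy ⊢
    obtain ⟨h1, h2⟩ := hy
    rw [neg_neg] at h2
    exact ⟨h2, h1⟩

end IsMaxtame

/-- The configuration of the boundary points of a maxtame set. -/
noncomputable def boundaryConfig (U : MaxtameSpace) : OddConfig :=
  ⟨U.2.exists_frontier_eq.choose,
    (U.2.eq_signRegion_repTuple U.2.exists_frontier_eq.choose_spec).1⟩

lemma frontier_eq_boundaryConfig (U : MaxtameSpace) :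
    frontier U.1 = toRPLine ⁻¹' ((boundaryConfig U).1 : Set RPLine) :=
  U.2.exists_frontier_eq.choose_spec

lemma boundaryConfig_eq_iff {U : MaxtameSpace} {F : OddConfig} :
    boundaryConfig U = F ↔ frontier U.1 = toRPLine ⁻¹' (F.1 : Set RPLine) := by
  constructor
  · rintro rfl
    exact frontier_eq_boundaryConfig U
  · intro h
    rw [frontier_eq_boundaryConfig] at h
    exact Subtype.ext (Finset.coe_injective (toRPLine_surjective.preimage_injective h))

/-- The point of the configuration space given by an odd number of points of the circle. -/
def MaxtameSpace.ofTuple {l : ℕ} (hl : Odd l) (v : Fin l → Circ) : MaxtameSpace :=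
  ⟨signRegion v, isMaxtame_signRegion hl v⟩

namespace MaxtameSpace

lemma boundaryConfig_ofTuple {l : ℕ} (hl : Odd l) (v : Fin l → Circ) :
    boundaryConfig (ofTuple hl v) = toOddConfig l hl fun i => toRPLine (v i) :=
  boundaryConfig_eq_iff.mpr (frontier_signRegion hl v)

lemma exists_ofTuple (U : MaxtameSpace) : ∃ l, ∃ hl : Odd l, ∃ v : Fin l → Circ, ofTuple hl v = U := by
  obtain ⟨hodd, h | h⟩ := U.2.eq_signRegion_repTuple (frontier_eq_boundaryConfig U)
  · exact ⟨_, hodd, _, Subtype.ext h.symm⟩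
  · exact ⟨_, hodd, _, Subtype.ext h.symm⟩

/-- The antipodal set of a maxtame set. -/
def antipode (U : MaxtameSpace) : MaxtameSpace :=
  ⟨(fun x => -x) ⁻¹' U.1, by
    obtain ⟨l, hl, v, rfl⟩ := exists_ofTuple U
    have := isMaxtame_signRegion hl (-v)
    rwa [signRegion_neg] at this⟩

lemma antipode_ofTuple {l : ℕ} (hl : Odd l) (v : Fin l → Circ) :
    antipode (ofTuple hl v) = ofTuple hl (-v) := Subtype.ext (signRegion_neg v).symm

lemma antipode_antipode (U : MaxtameSpace) : antipode (antipode U) = U := by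
  apply Subtype.ext
  ext x
  simp [antipode]

lemma nonempty (U : MaxtameSpace) : U.1.Nonempty := by
  rcases U.1.eq_empty_or_nonempty with h | h
  · have := U.2.closure_union (mk 1 0 (by norm_num))
    simp [h] at this
  · exact h

lemma antipode_ne (U : MaxtameSpace) : antipode U ≠ U := by
  intro h
  obtain ⟨x, hx⟩ := U.nonempty
  have : x ∈ (antipode U).1 := by rwa [h]
  exact U.2.neg_notMem hx this

lemma boundaryConfig_antipode (U : MaxtameSpace) :
    boundaryConfig (antipode U) = boundaryConfig U := by
  obtain ⟨l, hl, v, rfl⟩ := exists_ofTuple U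
  rw [antipode_ofTuple, boundaryConfig_ofTuple, boundaryConfig_ofTuple]
  simp only [Pi.neg_apply, toRPLine_neg]

/-- With the same frontier, both sets are regions of the same representative tuple up to a global
sign. -/
lemma boundaryConfig_eq_boundaryConfig_iff {U V : MaxtameSpace} :
    boundaryConfig U = boundaryConfig V ↔ U = V ∨ U = antipode V := by
  constructor
  · intro h
    have hF := frontier_eq_boundaryConfig U
    rw [h] at hF
    have hV := (V.2.eq_signRegion_repTuple (frontier_eq_boundaryConfig V)).2
    obtain ⟨hodd, hU⟩ := U.2.eq_signRegion_repTuple hF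
    set w := repTuple (boundaryConfig V).1
    have hn := antipode_ofTuple hodd w
    have hn' := antipode_ofTuple hodd (-w)
    rw [neg_neg] at hn'
    rcases hU with hU | hU <;> rcases hV with hV | hV
    · exact Or.inl (Subtype.ext (hU.trans hV.symm))
    · right
      have hV' : V = ofTuple hodd (-w) := Subtype.ext hV
      exact (Subtype.ext hU : U = ofTuple hodd w).trans
        (hn'.symm.trans (congrArg antipode hV'.symm))
    · right
      have hV' : V = ofTuple hodd w := Subtype.ext hV
      exact (Subtype.ext hU : U = ofTuple hodd (-w)).trans
        (hn.symm.trans (congrArg antipode hV'.symm))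
    · exact Or.inl (Subtype.ext (hU.trans hV.symm))
  · rintro (rfl | rfl)
    · rfl
    · exact boundaryConfig_antipode V

lemma boundaryConfig_surjective : Function.Surjective boundaryConfig := by
  intro F
  refine ⟨ofTuple F.2 (repTuple F.1), ?_⟩
  rw [boundaryConfig_ofTuple]
  exact Subtype.ext (oddPart_repTuple F.1)

lemma ncard_fiber (F : OddConfig) : (boundaryConfig ⁻¹' {F}).ncard = 2 := by
  obtain ⟨U, rfl⟩ := boundaryConfig_surjective F
  have : boundaryConfig ⁻¹' {boundaryConfig U} = {U, antipode U} := by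
    ext V
    rw [Set.mem_preimage, Set.mem_singleton_iff, boundaryConfig_eq_boundaryConfig_iff]
    rfl
  rw [this, Set.ncard_pair (antipode_ne U).symm]

end MaxtameSpace

/-! ### Binary forms on the circle -/

/-- The first coordinate function. -/
def coordX (x : Circ) : ℝ := x.1 0

/-- The second coordinate function. -/
def coordY (x : Circ) : ℝ := x.1 1

lemma continuous_coordX : Continuous coordX := continuous_coord 0

lemma continuous_coordY : Continuous coordY := continuous_coord 1

lemma coordY_mul_self : coordY * coordY = 1 - coordX * coordX := by
  ext x
  have := sq_add_sq x
  simp only [Pi.mul_apply, Pi.sub_apply, Pi.one_apply, coordX, coordY]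
  linarith

/-- The linear forms, as functions on the circle; `linForms ^ d` are the binary forms of
degree `d`. -/
noncomputable def linForms : Submodule ℝ (Circ → ℝ) := Submodule.span ℝ {coordX, coordY}

lemma coordX_mem : coordX ∈ linForms := Submodule.subset_span (by simp)

lemma coordY_mem : coordY ∈ linForms := Submodule.subset_span (by simp)

lemma wedge_mem_linForms (v : Circ) : wedge v ∈ linForms := by
  have : wedge v = v.1 0 • coordY - v.1 1 • coordX := rfl
  rw [this]
  exact sub_mem (Submodule.smul_mem _ _ coordY_mem) (Submodule.smul_mem _ _ coordX_mem)

/-- Linear forms are rewritten in the frame of `v`, which makes division by `det (v, x)` accessible.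
-/
lemma linForms_eq_span (v : Circ) : linForms = Submodule.span ℝ {dotp v} ⊔ Submodule.span ℝ {wedge v} := by
  apply le_antisymm
  · rw [linForms, Submodule.span_le, ← Submodule.span_union, Set.singleton_union]
    have hd : dotp v ∈ Submodule.span ℝ {dotp v, wedge v} := Submodule.subset_span (by simp)
    have hw : wedge v ∈ Submodule.span ℝ {dotp v, wedge v} := Submodule.subset_span (by simp)
    rintro f (rfl | rfl)
    · have : coordX = v.1 0 • dotp v - v.1 1 • wedge v := by
        ext x
        simp only [Pi.sub_apply, Pi.smul_apply, smul_eq_mul, coordX]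
        linear_combination coord_zero_eq v x
      rw [this]
      exact sub_mem (Submodule.smul_mem _ _ hd) (Submodule.smul_mem _ _ hw)
    · have : coordY = v.1 1 • dotp v + v.1 0 • wedge v := by
        ext x
        simp only [Pi.add_apply, Pi.smul_apply, smul_eq_mul, coordY]
        linear_combination coord_one_eq v x
      rw [this]
      exact add_mem (Submodule.smul_mem _ _ hd) (Submodule.smul_mem _ _ hw)
  · rw [sup_le_iff, Submodule.span_singleton_le_iff_mem, Submodule.span_singleton_le_iff_mem]
    refine ⟨?_, wedge_mem_linForms v⟩
    have : dotp v = v.1 0 • coordX + v.1 1 • coordY := rfl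
    rw [this]
    exact add_mem (Submodule.smul_mem _ _ coordX_mem) (Submodule.smul_mem _ _ coordY_mem)

lemma exists_split_of_mem_pow_succ (v : Circ) {d : ℕ} {q : Circ → ℝ} (hq : q ∈ linForms ^ (d + 1)) :
    ∃ a ∈ linForms ^ d, ∃ b ∈ linForms ^ d, q = a * dotp v + b * wedge v := by
  rw [pow_succ, linForms_eq_span v, Submodule.mul_sup, ← linForms_eq_span v,
    Submodule.mem_sup] at hq
  obtain ⟨_, h1, _, h2, rfl⟩ := hq
  obtain ⟨a, ha, rfl⟩ := Submodule.mem_mul_span_singleton.mp h1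
  obtain ⟨b, hb, rfl⟩ := Submodule.mem_mul_span_singleton.mp h2
  exact ⟨a, ha, b, hb, rfl⟩

/-- Division by `det (v, x)` in coordinates adapted to `v`: only the pure power of the other
coordinate survives as remainder, and evaluation at `v` reads off its coefficient. -/
lemma exists_eq_smul_pow_add (v : Circ) (d : ℕ) : ∀ {q : Circ → ℝ}, q ∈ linForms ^ (d + 1) →
    ∃ c : ℝ, ∃ r ∈ linForms ^ d, q = c • dotp v ^ (d + 1) + wedge v * r := by
  induction d with
  | zero =>
    intro q hq
    obtain ⟨a, ha, b, hb, rfl⟩ := exists_split_of_mem_pow_succ v hq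
    rw [pow_zero, Submodule.mem_one] at ha
    obtain ⟨c, rfl⟩ := ha
    refine ⟨c, b, hb, ?_⟩
    rw [Algebra.smul_def]
    ring
  | succ d ih =>
    intro q hq
    obtain ⟨a, ha, b, hb, rfl⟩ := exists_split_of_mem_pow_succ v hq
    obtain ⟨c, r, hr, rfl⟩ := ih ha
    refine ⟨c, r * dotp v + b, add_mem ?_ hb, ?_⟩
    · rw [pow_succ]
      refine Submodule.mul_mem_mul hr ?_
      rw [linForms_eq_span v]
      exact Submodule.mem_sup_left (Submodule.mem_span_singleton_self _)
    · simp only [Algebra.smul_def]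
      ring

/-- A form that vanishes at `v` is divisible by `det (v, x)`. -/
lemma exists_eq_wedge_mul {v : Circ} {d : ℕ} {q : Circ → ℝ} (hq : q ∈ linForms ^ (d + 1))
    (hv : q v = 0) : ∃ r ∈ linForms ^ d, q = wedge v * r := by
  obtain ⟨c, r, hr, rfl⟩ := exists_eq_smul_pow_add v d hq
  have hc : c = 0 := by
    simpa [wedge_self, dotp_self] using hv
  exact ⟨r, hr, by rw [hc, zero_smul, zero_add]⟩

lemma wedgeProd_mem {l : ℕ} (v : Fin l → Circ) : wedgeProd v ∈ linForms ^ l := by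
  induction l with
  | zero =>
    rw [pow_zero, Submodule.mem_one]
    exact ⟨1, by ext x; simp [wedgeProd]⟩
  | succ l ih =>
    have : wedgeProd v = wedgeProd (fun i : Fin l => v i.castSucc) * wedge (v (Fin.last l)) := by
      ext x
      simp [wedgeProd, Fin.prod_univ_castSucc]
    rw [this, pow_succ]
    exact Submodule.mul_mem_mul (ih _) (wedge_mem_linForms _)

lemma continuous_and_neg_of_mem (d : ℕ) : ∀ {q : Circ → ℝ}, q ∈ linForms ^ d →
    Continuous q ∧ ∀ x, q (-x) = (-1) ^ d * q x := by
  induction d with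
  | zero =>
    intro q hq
    rw [pow_zero, Submodule.mem_one] at hq
    obtain ⟨c, rfl⟩ := hq
    exact ⟨continuous_const, fun x => by simp⟩
  | succ d ih =>
    intro q hq
    obtain ⟨a, ha, b, hb, rfl⟩ := exists_split_of_mem_pow_succ (mk 1 0 (by norm_num)) hq
    obtain ⟨ha1, ha2⟩ := ih ha
    obtain ⟨hb1, hb2⟩ := ih hb
    refine ⟨(ha1.mul (continuous_dotp_right _)).add (hb1.mul (continuous_wedge_right _)),
      fun x => ?_⟩
    simp only [Pi.add_apply, Pi.mul_apply, ha2, hb2, dotp_neg_right, wedge_neg_right]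
    ring

/-- Every zero on the circle splits off a linear factor, so induction on the degree leaves a form
without zeros. -/
lemma exists_factorization (d : ℕ) : ∀ {q : Circ → ℝ}, q ∈ linForms ^ d → q ≠ 0 →
    ∃ k j, k + j = d ∧ ∃ v : Fin k → Circ, ∃ g ∈ linForms ^ j, (∀ x, g x ≠ 0) ∧
      q = wedgeProd v * g := by
  induction d with
  | zero =>
    intro q hq hq0
    refine ⟨0, 0, rfl, Fin.elim0, q, hq, fun x hx => hq0 ?_, ?_⟩
    · rw [pow_zero, Submodule.mem_one] at hq
      obtain ⟨c, rfl⟩ := hq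
      have : c = 0 := by simpa using hx
      rw [this, map_zero]
    · ext x
      simp [wedgeProd]
  | succ d ih =>
    intro q hq hq0
    by_cases h : ∃ v, q v = 0
    · obtain ⟨a, ha⟩ := h
      obtain ⟨r, hr, rfl⟩ := exists_eq_wedge_mul hq ha
      obtain ⟨k, j, hkj, v, g, hg, hg0, rfl⟩ := ih hr (by rintro rfl; simp at hq0)
      refine ⟨k + 1, j, by omega, Fin.cons a v, g, hg, hg0, ?_⟩
      ext x
      simp only [Pi.mul_apply, wedgeProd_cons]
      ring
    · push Not at h
      refine ⟨0, d + 1, by omega, Fin.elim0, q, hq, h, ?_⟩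
      ext x
      simp [wedgeProd]

/-- The sign of a nonzero form of odd degree `d` is that of a product of `d` linear forms. -/
theorem exists_wedgeProd_sign {d : ℕ} (hd : Odd d) {q : Circ → ℝ} (hq : q ∈ linForms ^ d)
    (hq0 : q ≠ 0) : ∃ v : Fin d → Circ, ∀ x, wedgeProd v x ≠ 0 → 0 < q x * wedgeProd v x := by
  obtain ⟨k, j, rfl, v, g, hg, hg0, rfl⟩ := exists_factorization d hq hq0
  obtain ⟨hgc, hgn⟩ := continuous_and_neg_of_mem j hg
  have hsign : (∀ x, 0 < g x) ∨ ∀ x, g x < 0 := by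
    by_contra! h
    obtain ⟨⟨x, hx⟩, y, hy⟩ := h
    obtain ⟨z, -, hz⟩ := isPreconnected_univ.intermediate_value (Set.mem_univ x) (Set.mem_univ y)
      hgc.continuousOn ⟨hx, hy⟩
    exact hg0 z hz
  -- A form of odd degree takes opposite values at antipodes and cannot have constant sign.
  have hj : Even j := by
    by_contra hj
    rw [Nat.not_even_iff_odd] at hj
    have h := hgn (mk 1 0 (by norm_num))
    rw [hj.neg_one_pow] at h
    rcases hsign with hs | hs
    · have h1 := hs (mk 1 0 (by norm_num))
      have h2 := hs (-mk 1 0 (by norm_num))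
      linarith
    · have h1 := hs (mk 1 0 (by norm_num))
      have h2 := hs (-mk 1 0 (by norm_num))
      linarith
  have hk : Odd k := by
    rcases Nat.even_or_odd k with h | h
    · exact absurd hd (Nat.not_odd_iff_even.mpr (h.add hj))
    · exact h
  -- A negative `g` is absorbed by negating all `k` vectors, because `k` is odd.
  have key : ∃ u : Fin k → Circ, ∀ x, wedgeProd u x ≠ 0 → 0 < wedgeProd v x * g x * wedgeProd u x := by
    rcases hsign with hs | hs
    · refine ⟨v, fun x hx => ?_⟩
      have := mul_pos (hs x) (mul_self_pos.mpr hx)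
      linarith
    · refine ⟨-v, fun x hx => ?_⟩
      rw [wedgeProd_neg_left, hk.neg_one_pow] at hx ⊢
      have hx' : wedgeProd v x ≠ 0 := fun h => by simp [h] at hx
      have := mul_pos (neg_pos.mpr (hs x)) (mul_self_pos.mpr hx')
      linarith
  obtain ⟨u, hu⟩ := key
  -- The zero-free factor is replaced by `j` copies of one linear form, an even power, to restore
  -- the number `d` of factors.
  have hconst : ∀ x, wedgeProd (fun _ : Fin j => mk 1 0 (by norm_num)) x
      = wedge (mk 1 0 (by norm_num)) x ^ j := fun x => by simp [wedgeProd]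
  refine ⟨Fin.append u fun _ => mk 1 0 (by norm_num), fun x hx => ?_⟩
  rw [wedgeProd_append, hconst] at hx ⊢
  have h1 := hu x (left_ne_zero_of_mul hx)
  have h2 := lt_of_le_of_ne (hj.pow_nonneg _) (Ne.symm (right_ne_zero_of_mul hx))
  have := mul_pos h1 h2
  simp only [Pi.mul_apply]
  linarith

/-! ### A common basis for the forms of odd degree -/

/-- The functions `x, y, x³, x² y, x⁵, x⁴ y, …`; the first `2 n + 2` of them are a basis of the
forms of degree `2 n + 1` on the circle. -/
def formBasis (i : ℕ) : Circ → ℝ := coordX ^ (2 * (i / 2)) * if Even i then coordX else coordY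

lemma formBasis_even (j : ℕ) : formBasis (2 * j) = coordX ^ (2 * j + 1) := by
  rw [formBasis, if_pos (even_two_mul j), Nat.mul_div_cancel_left j two_pos, pow_succ]

lemma formBasis_odd (j : ℕ) : formBasis (2 * j + 1) = coordX ^ (2 * j) * coordY := by
  rw [formBasis, if_neg (by simp), show (2 * j + 1) / 2 = j by omega]

lemma formBasis_add_two (i : ℕ) : formBasis (i + 2) = coordX ^ 2 * formBasis i := by
  rcases Nat.even_or_odd' i with ⟨j, rfl | rfl⟩
  · rw [show 2 * j + 2 = 2 * (j + 1) by ring, formBasis_even, formBasis_even]; ring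
  · rw [show 2 * j + 1 + 2 = 2 * (j + 1) + 1 by ring, formBasis_odd, formBasis_odd]; ring

lemma continuous_formBasis (i : ℕ) : Continuous (formBasis i) := by
  rcases Nat.even_or_odd' i with ⟨j, rfl | rfl⟩
  · rw [formBasis_even]; exact continuous_coordX.pow _
  · rw [formBasis_odd]; exact (continuous_coordX.pow _).mul continuous_coordY

lemma linForms_pow_le_add_two (d : ℕ) : linForms ^ d ≤ linForms ^ (d + 2) := by
  intro q hq
  have h1 : (1 : Circ → ℝ) ∈ linForms ^ 2 := by
    have : (1 : Circ → ℝ) = coordX * coordX + coordY * coordY := by rw [coordY_mul_self]; ring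
    rw [this, pow_two]
    exact add_mem (Submodule.mul_mem_mul coordX_mem coordX_mem)
      (Submodule.mul_mem_mul coordY_mem coordY_mem)
  rw [pow_add]
  simpa using Submodule.mul_mem_mul hq h1

lemma formBasis_mem (n : ℕ) : ∀ {i : ℕ}, i < 2 * n + 2 → formBasis i ∈ linForms ^ (2 * n + 1) := by
  induction n with
  | zero =>
    intro i hi
    rw [mul_zero, zero_add, pow_one]
    interval_cases i
    · simpa using (formBasis_even 0).symm ▸ (by simpa using coordX_mem)
    · simpa using (formBasis_odd 0).symm ▸ (by simpa using coordY_mem)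
  | succ n ih =>
    intro i hi
    rcases lt_or_ge i (2 * n + 2) with h | h
    · exact linForms_pow_le_add_two _ (ih h)
    · obtain ⟨k, rfl⟩ := Nat.exists_eq_add_of_le' (show 2 ≤ i by omega)
      rw [formBasis_add_two, show 2 * (n + 1) + 1 = 2 * n + 1 + 2 by ring, pow_add, mul_comm (coordX ^ 2)]
      exact Submodule.mul_mem_mul (ih (by omega)) (Submodule.pow_mem_pow _ coordX_mem 2)

/-- Raising the degree by two multiplies by `x²`, `x y` or `y²`; replacing `y²` by `1 - x²` brings
each product back to the listed functions. -/
lemma linForms_pow_le_span (n : ℕ) :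
    linForms ^ (2 * n + 1) ≤ Submodule.span ℝ (formBasis '' {i | i < 2 * n + 2}) := by
  induction n with
  | zero =>
    rw [mul_zero, zero_add, pow_one, linForms, Submodule.span_le]
    rintro f (rfl | rfl)
    · exact Submodule.subset_span ⟨0, by simp, by simpa using formBasis_even 0⟩
    · exact Submodule.subset_span ⟨1, by simp, by simpa using formBasis_odd 0⟩
  | succ n ih =>
    have h1 : linForms ^ (2 * (n + 1) + 1) = linForms ^ (2 * n + 1) * (linForms * linForms) := by ring
    rw [h1]
    refine (mul_le_mul' ih le_rfl).trans ?_
    rw [linForms, Submodule.span_mul_span, Submodule.span_mul_span, Submodule.span_le]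
    have hmem : ∀ i, i < 2 * (n + 1) + 2 →
        formBasis i ∈ Submodule.span ℝ (formBasis '' {i | i < 2 * (n + 1) + 2}) :=
      fun i hi => Submodule.subset_span ⟨i, hi, rfl⟩
    have hXY : ∀ i, i < 2 * n + 2 → formBasis i * (coordX * coordY) ∈
        Submodule.span ℝ (formBasis '' {i | i < 2 * (n + 1) + 2}) := by
      intro i hi
      rcases Nat.even_or_odd' i with ⟨j, rfl | rfl⟩
      · have : formBasis (2 * j) * (coordX * coordY) = formBasis (2 * (j + 1) + 1) := by
          rw [formBasis_even, formBasis_odd]; ring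
        rw [this]
        exact hmem _ (by omega)
      · have : formBasis (2 * j + 1) * (coordX * coordY) =
            formBasis (2 * j) - formBasis (2 * (j + 1)) := by
          rw [formBasis_even, formBasis_odd, formBasis_even]
          calc _ = coordX ^ (2 * j + 1) * (coordY * coordY) := by ring
            _ = _ := by rw [coordY_mul_self]; ring
        rw [this]
        exact sub_mem (hmem _ (by omega)) (hmem _ (by omega))
    rintro _ ⟨_, ⟨i, hi, rfl⟩, _, ⟨u, hu, w, hw, rfl⟩, rfl⟩
    have hi' : i < 2 * n + 2 := hi
    rcases hu with rfl | rfl <;> rcases hw with rfl | rfl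
    · have : formBasis i * (coordX * coordX) = formBasis (i + 2) := by
        rw [formBasis_add_two]; ring
      simp only [SetLike.mem_coe, this]
      exact hmem _ (by omega)
    · exact hXY i hi
    · simp only [mul_comm coordY coordX]
      exact hXY i hi
    · have : formBasis i * (coordY * coordY) = formBasis i - formBasis (i + 2) := by
        rw [coordY_mul_self, formBasis_add_two]; ring
      simp only [SetLike.mem_coe, this]
      exact sub_mem (hmem _ (by omega)) (hmem _ (by omega))

/-- The linear combination of the basis forms with coefficients `a`. -/
def formComb {N : ℕ} (a : Fin N → ℝ) (x : Circ) : ℝ := ∑ i, a i * formBasis i x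

lemma continuous_formComb {N : ℕ} (a : Fin N → ℝ) : Continuous (formComb a) :=
  continuous_finsetSum _ fun i _ => continuous_const.mul (continuous_formBasis i)

lemma formComb_mem (n : ℕ) (a : Fin (2 * n + 2) → ℝ) : formComb a ∈ linForms ^ (2 * n + 1) := by
  have : formComb a = ∑ i, a i • formBasis i := by
    ext x; simp [formComb]
  rw [this]
  exact Submodule.sum_mem _ fun i _ => Submodule.smul_mem _ _ (formBasis_mem n i.2)

lemma exists_formComb_eq {n : ℕ} {q : Circ → ℝ} (hq : q ∈ linForms ^ (2 * n + 1)) :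
    ∃ a : Fin (2 * n + 2) → ℝ, q = formComb a := by
  have h := linForms_pow_le_span n hq
  have hr : formBasis '' {i | i < 2 * n + 2} = Set.range fun i : Fin (2 * n + 2) => formBasis i := by
    ext f
    constructor
    · rintro ⟨i, hi, rfl⟩
      exact ⟨⟨i, hi⟩, rfl⟩
    · rintro ⟨i, rfl⟩
      exact ⟨i, i.2, rfl⟩
  rw [hr, Submodule.mem_span_range_iff_exists_fun] at h
  obtain ⟨a, rfl⟩ := h
  exact ⟨a, by ext x; simp [formComb]⟩

/-- Evaluation at `(0, 1)` kills the coefficient of `y`. Dividing by `x` on the dense set `x ≠ 0`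
and evaluating there again kills that of `x`; a second division leaves a shorter relation. -/
lemma formBasis_linearIndependent_aux (n : ℕ) : ∀ a : ℕ → ℝ,
    (∀ x, ∑ i ∈ Finset.range (2 * n), a i * formBasis i x = 0) → ∀ i < 2 * n, a i = 0 := by
  induction n with
  | zero => intro a _ i hi; omega
  | succ n ih =>
    intro a ha
    set S : Circ → ℝ := fun x => ∑ i ∈ Finset.range (2 * n), a (i + 2) * formBasis i x with hS
    have hSc : Continuous S :=
      continuous_finsetSum _ fun i _ => continuous_const.mul (continuous_formBasis i)
    have hsum : ∀ x, coordX x ^ 2 * S x + a 0 * coordX x + a 1 * coordY x = 0 := by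
      intro x
      have h := ha x
      rw [show 2 * (n + 1) = 2 * n + 1 + 1 by ring, Finset.sum_range_succ', Finset.sum_range_succ'] at h
      have h0 : formBasis 0 x = coordX x := by simpa using congrFun (formBasis_even 0) x
      have h1 : formBasis 1 x = coordY x := by simpa using congrFun (formBasis_odd 0) x
      rw [zero_add, h0, h1] at h
      rw [← h, hS, Finset.mul_sum]
      have : ∀ i, coordX x ^ 2 * (a (i + 2) * formBasis i x) = a (i + 1 + 1) * formBasis (i + 1 + 1) x := by
        intro i
        rw [formBasis_add_two]
        simp only [Pi.mul_apply, Pi.pow_apply]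
        ring
      simp only [this]
      ring
    set z : Circ := mk 0 1 (by norm_num)
    have hz0 : coordX z = 0 := mk_zero _ _ _
    have hz1 : coordY z = 1 := mk_one _ _ _
    have ha1 : a 1 = 0 := by
      have := hsum z
      rw [hz0, hz1] at this
      linarith
    have hdense : Dense {x | coordX x ≠ 0} := by
      have hfin : {x : Circ | wedge z x = 0}.Finite :=
        (Set.toFinite {z, -z}).subset fun x hx => wedge_eq_zero_iff.mp hx
      convert dense_compl_of_finite hfin using 1
      ext x
      simp [wedge, z, coordX]
    have hcancel : ∀ x, coordX x * S x + a 0 = 0 := by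
      intro x
      refine congrFun (Continuous.ext_on hdense ((continuous_coordX.mul hSc).add continuous_const)
        continuous_const (g := fun _ => (0 : ℝ)) ?_) x
      intro y hy
      have h := hsum y
      rw [ha1] at h
      have : coordX y * (coordX y * S y + a 0) = 0 := by linear_combination h
      exact (mul_eq_zero.mp this).resolve_left hy
    have ha0 : a 0 = 0 := by
      have := hcancel z
      rw [hz0] at this
      linarith
    have hS0 : ∀ x, S x = 0 := by
      intro x
      refine congrFun (Continuous.ext_on hdense hSc continuous_const (g := fun _ => (0 : ℝ)) ?_) x
      intro y hy
      have h := hcancel y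
      rw [ha0, add_zero] at h
      exact (mul_eq_zero.mp h).resolve_left hy
    have := ih (fun i => a (i + 2)) hS0
    intro i hi
    rcases i with _ | _ | i
    · exact ha0
    · exact ha1
    · exact this i (by omega)

lemma formComb_ne_zero {n : ℕ} {a : Fin (2 * n + 2) → ℝ} (ha : a ≠ 0) : formComb a ≠ 0 := by
  intro h
  apply ha
  have := formBasis_linearIndependent_aux (n + 1)
    (fun i => if hi : i < 2 * n + 2 then a ⟨i, hi⟩ else 0) (fun x => by
      have hx := congrFun h x
      rw [show 2 * (n + 1) = 2 * n + 2 by ring, Finset.sum_range]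
      simpa [formComb] using hx)
  ext i
  have := this i (by omega)
  simpa using this

open MeasureTheory

/-! ### Moments of maxtame sets -/

/-- The arc length measure on the circle. -/
noncomputable def arcMeasure : Measure Circ := (volume : Measure Plane).toSphere

instance : IsFiniteMeasure arcMeasure := by unfold arcMeasure; infer_instance

instance : arcMeasure.IsOpenPosMeasure := by unfold arcMeasure; infer_instance

/-- The cone over a point lies in a line, which is null in the plane. -/
instance : NullSingletonClass arcMeasure where
  measure_singleton x := by
    rw [arcMeasure, Measure.toSphere_apply' _ (measurableSet_singleton x)]
    refine mul_eq_zero_of_right _ (measure_mono_null ?_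
      (Measure.addHaar_submodule volume (Submodule.span ℝ {x.1}) ?_))
    · rw [Set.image_singleton]
      rintro _ ⟨r, -, _, rfl, rfl⟩
      exact Submodule.smul_mem _ _ (Submodule.mem_span_singleton_self _)
    · intro h
      have h1 := finrank_span_singleton (K := ℝ) (v := x.1) (by
        rintro h0
        have := x.2
        rw [h0] at this
        simp at this)
      rw [h, finrank_top] at h1
      simp at h1

lemma ae_ne_zero_of_finite {p : Circ → ℝ} (hp : {x | p x = 0}.Finite) :
    ∀ᵐ x ∂arcMeasure, p x ≠ 0 := by
  rw [ae_iff]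
  simpa using hp.measure_zero arcMeasure

lemma measurable_sign : Measurable Real.sign := by
  unfold Real.sign
  exact Measurable.ite measurableSet_Iio measurable_const
    (Measurable.ite measurableSet_Ioi measurable_const measurable_const)

lemma abs_sign_le (r : ℝ) : |Real.sign r| ≤ 1 := by
  rcases Real.sign_apply_eq r with h | h | h <;> simp [h]

lemma sign_mul_self_eq_abs (r : ℝ) : Real.sign r * r = |r| := by
  rcases lt_trichotomy r 0 with h | h | h
  · rw [Real.sign_of_neg h, abs_of_neg h]; ring
  · simp [h]
  · rw [Real.sign_of_pos h, abs_of_pos h]; ring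

lemma integrable_of_continuous {q : Circ → ℝ} (hq : Continuous q) : Integrable q arcMeasure :=
  hq.integrable_of_hasCompactSupport (HasCompactSupport.of_compactSpace q)

lemma integrable_sign_mul {p q : Circ → ℝ} (hp : Continuous p) (hq : Continuous q) :
    Integrable (fun x => Real.sign (p x) * q x) arcMeasure := by
  refine (integrable_of_continuous hq).mono
    ((measurable_sign.comp hp.measurable).mul hq.measurable).aestronglyMeasurable ?_
  refine Filter.Eventually.of_forall fun x => ?_
  rw [norm_mul]
  exact mul_le_of_le_one_left (norm_nonneg _) (abs_sign_le _)

/-- The moments of the sign of the product of the `det (v_j, x)`. -/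
noncomputable def tupleMoment {l : ℕ} (v : Fin l → Circ) (i : ℕ) : ℝ :=
  ∫ x, Real.sign (wedgeProd v x) * formBasis i x ∂arcMeasure

/-- The moments of a maxtame set. -/
noncomputable def MaxtameSpace.moment (U : MaxtameSpace) (i : ℕ) : ℝ :=
  ∫ x, antipodalSign U.1 x * formBasis i x ∂arcMeasure

lemma ae_wedgeProd_ne {l : ℕ} (v : Fin l → Circ) : ∀ᵐ x ∂arcMeasure, wedgeProd v x ≠ 0 :=
  ae_ne_zero_of_finite (finite_wedgeProd_zeros v)

lemma antipodalSign_signRegion {l : ℕ} (hl : Odd l) (v : Fin l → Circ) {x : Circ}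
    (hx : wedgeProd v x ≠ 0) : antipodalSign (signRegion v) x = Real.sign (wedgeProd v x) := by
  rcases hx.lt_or_gt with h | h
  · rw [Real.sign_of_neg h, (isMaxtame_signRegion hl v).antipodalSign_of_neg_mem
      (mem_signRegion_of_pos v (pos_ofOdd hl h))]
  · rw [Real.sign_of_pos h, IsMaxtame.antipodalSign_of_mem (mem_signRegion_of_pos v h)]

namespace MaxtameSpace

lemma moment_ofTuple {l : ℕ} (hl : Odd l) (v : Fin l → Circ) :
    moment (ofTuple hl v) = tupleMoment v := by
  ext i
  refine integral_congr_ae ?_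
  filter_upwards [ae_wedgeProd_ne v] with x hx
  rw [← antipodalSign_signRegion hl v hx]
  rfl

lemma moment_antipode (U : MaxtameSpace) (i : ℕ) : moment (antipode U) i = -moment U i := by
  rw [moment, moment, ← integral_neg]
  refine integral_congr_ae (Filter.Eventually.of_forall fun x => ?_)
  have : antipodalSign (antipode U).1 x = antipodalSign U.1 (-x) := by
    by_cases h : x ∈ (antipode U).1
    · rw [IsMaxtame.antipodalSign_of_mem h]
      exact (IsMaxtame.antipodalSign_of_mem (U := U.1) h).symm
    · by_cases h' : -x ∈ (antipode U).1
      · rw [(antipode U).2.antipodalSign_of_neg_mem h']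
        exact (U.2.antipodalSign_of_neg_mem (x := -x) h').symm
      · have h1 : -x ∉ U.1 := h
        have h2 : - -x ∉ U.1 := h'
        rw [antipodalSign, if_neg h, if_neg h', antipodalSign, if_neg h1, if_neg h2]
  simp only [this, U.2.antipodalSign_neg]
  ring

end MaxtameSpace

/-! ### Continuity of the moments and recovery of the region -/

lemma continuous_wedgeProd_left {l : ℕ} (x : Circ) :
    Continuous fun v : Fin l → Circ => wedgeProd v x := by
  refine continuous_finsetProd _ fun j _ => ?_
  exact continuous_wedge.comp (f := fun v : Fin l → Circ => (v j, x))
    ((continuous_apply j).prodMk continuous_const)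

lemma continuousAt_sign {r : ℝ} (hr : r ≠ 0) : ContinuousAt Real.sign r := by
  rcases hr.lt_or_gt with h | h
  · refine continuousAt_const (y := (-1 : ℝ)) |>.congr ?_
    filter_upwards [Iio_mem_nhds h] with s hs
    exact (Real.sign_of_neg hs).symm
  · refine continuousAt_const (y := (1 : ℝ)) |>.congr ?_
    filter_upwards [Ioi_mem_nhds h] with s hs
    exact (Real.sign_of_pos hs).symm

/-- Dominated convergence: the sign jumps only at zeros of the product, a null set, so colliding
boundary points cause no discontinuity. -/
lemma continuous_tupleMoment {l : ℕ} (i : ℕ) :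
    Continuous fun v : Fin l → Circ => tupleMoment v i := by
  rw [continuous_iff_continuousAt]
  intro v₀
  refine continuousAt_of_dominated (bound := fun x => |formBasis i x|) ?_ ?_ ?_ ?_
  · exact Filter.Eventually.of_forall fun v =>
      (integrable_sign_mul (continuous_wedgeProd v) (continuous_formBasis i)).aestronglyMeasurable
  · refine Filter.Eventually.of_forall fun v => Filter.Eventually.of_forall fun x => ?_
    rw [norm_mul]
    exact mul_le_of_le_one_left (norm_nonneg _) (abs_sign_le _)
  · exact (integrable_of_continuous (continuous_formBasis i)).abs
  · filter_upwards [ae_wedgeProd_ne v₀] with x hx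
    exact ((continuousAt_sign hx).comp (f := fun v : Fin l → Circ => wedgeProd v x)
      (continuous_wedgeProd_left x).continuousAt).mul continuousAt_const

lemma integral_sign_mul_formComb {N : ℕ} {p : Circ → ℝ} (hp : Continuous p) (a : Fin N → ℝ) :
    ∫ x, Real.sign (p x) * formComb a x ∂arcMeasure =
      ∑ i, a i * ∫ x, Real.sign (p x) * formBasis i x ∂arcMeasure := by
  simp only [formComb, Finset.mul_sum]
  rw [integral_finsetSum]
  · refine Finset.sum_congr rfl fun i _ => ?_
    rw [← integral_const_mul]
    congr 1
    ext x
    ring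
  · intro i _
    have := (integrable_sign_mul hp (continuous_formBasis i)).const_mul (a i)
    refine this.congr (Filter.Eventually.of_forall fun x => ?_)
    ring

lemma integral_abs_pos {q : Circ → ℝ} (hq : Continuous q) (hq0 : q ≠ 0) :
    0 < ∫ x, |q x| ∂arcMeasure := by
  obtain ⟨z, hz⟩ := Function.ne_iff.mp hq0
  exact hq.abs.integral_pos_of_hasCompactSupport_nonneg_nonzero
    (HasCompactSupport.of_compactSpace _) (fun x => abs_nonneg _) (x := z) (abs_ne_zero.mpr hz)

lemma wedgeProd_ne_zero {l : ℕ} (v : Fin l → Circ) : wedgeProd v ≠ 0 := by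
  intro h
  obtain ⟨x, -, hx⟩ := inter_nonempty_of_finite_compl (finite_compl_wedgeProd_ne v)
    isOpen_univ Set.univ_nonempty
  exact hx (congrFun h x)

/-- Pairing the moments with the coefficients of the product itself gives its `L¹` norm. In
particular the first `2n+2` moments do not all vanish. -/
lemma exists_sum_tupleMoment {n : ℕ} (v : Fin (2 * n + 1) → Circ) :
    ∃ a : Fin (2 * n + 2) → ℝ, formComb a = wedgeProd v ∧
      0 < ∑ i, a i * tupleMoment v i := by
  obtain ⟨a, ha⟩ := exists_formComb_eq (wedgeProd_mem v)
  refine ⟨a, ha.symm, ?_⟩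
  have := integral_sign_mul_formComb (continuous_wedgeProd v) a
  rw [← ha] at this
  simp only [sign_mul_self_eq_abs] at this
  simp only [tupleMoment]
  rw [← this]
  exact integral_abs_pos (continuous_wedgeProd v) (wedgeProd_ne_zero v)

lemma exists_tupleMoment_ne_zero {n : ℕ} (v : Fin (2 * n + 1) → Circ) :
    ∃ i < 2 * n + 2, tupleMoment v i ≠ 0 := by
  obtain ⟨a, -, ha⟩ := exists_sum_tupleMoment v
  by_contra! h
  rw [Finset.sum_eq_zero fun i _ => by rw [h i i.2, mul_zero]] at ha
  exact ha.false

lemma signRegion_eq_of_nonneg {l k : ℕ} {v : Fin l → Circ} {w : Fin k → Circ}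
    (h : ∀ x, 0 ≤ wedgeProd w x * wedgeProd v x) : signRegion v = signRegion w := by
  have key : ∀ {l k : ℕ} {v : Fin l → Circ} {w : Fin k → Circ},
      (∀ x, 0 ≤ wedgeProd w x * wedgeProd v x) → signRegion v ⊆ signRegion w := by
    intro l k v w h
    have h1 : {x | 0 < wedgeProd v x} ⊆ signRegion w :=
      subset_signRegion w (isOpen_lt continuous_const (continuous_wedgeProd v))
        fun x hx => nonneg_of_mul_nonneg_left (h x) hx
    rw [signRegion_eq v, signRegion_eq w]
    refine interior_mono ?_
    rw [← closure_signRegion w]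
    exact closure_mono h1
  exact subset_antisymm (key h) (key fun x => by rw [mul_comm]; exact h x)

/-- The moments of order less than `2 n + 2` determine the region of a `2 n + 1`-tuple, even up to
positive multiples. -/
theorem signRegion_eq_of_tupleMoment {n : ℕ} {v w : Fin (2 * n + 1) → Circ} {t : ℝ} (ht : 0 < t)
    (h : ∀ i < 2 * n + 2, tupleMoment v i = t * tupleMoment w i) :
    signRegion v = signRegion w := by
  -- For `t > 1` the roles of `v` and `w` are exchanged.
  wlog ht1 : t ≤ 1 generalizing v w t
  · refine (this (inv_pos.mpr ht) (fun i hi => ?_) (inv_le_one_of_one_le₀ (not_le.mp ht1).le)).symm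
    rw [h i hi, inv_mul_cancel_left₀ ht.ne']
  obtain ⟨a, ha, hpos⟩ := exists_sum_tupleMoment v
  have h1 : ∫ x, Real.sign (wedgeProd v x) * wedgeProd v x ∂arcMeasure =
      ∑ i, a i * tupleMoment v i := by
    rw [← ha]
    exact integral_sign_mul_formComb (continuous_formComb a) a |>.trans (by rw [ha]; rfl)
  have h2 : ∫ x, Real.sign (wedgeProd w x) * wedgeProd v x ∂arcMeasure =
      ∑ i, a i * tupleMoment w i := by
    rw [← ha]
    exact integral_sign_mul_formComb (continuous_wedgeProd w) a
  have h3 : ∑ i, a i * tupleMoment v i = t * ∑ i, a i * tupleMoment w i := by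
    rw [Finset.mul_sum]
    refine Finset.sum_congr rfl fun i _ => ?_
    rw [h i i.2]
    ring
  have hint : Integrable (fun x => Real.sign (wedgeProd v x) * wedgeProd v x -
      Real.sign (wedgeProd w x) * wedgeProd v x) arcMeasure :=
    (integrable_sign_mul (continuous_wedgeProd v) (continuous_wedgeProd v)).sub
      (integrable_sign_mul (continuous_wedgeProd w) (continuous_wedgeProd v))
  have hnn : ∀ x, 0 ≤ Real.sign (wedgeProd v x) * wedgeProd v x -
      Real.sign (wedgeProd w x) * wedgeProd v x := by
    intro x
    rw [sign_mul_self_eq_abs, sub_nonneg]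
    refine (le_abs_self _).trans ?_
    rw [abs_mul]
    exact mul_le_of_le_one_left (abs_nonneg _) (abs_sign_le _)
  -- With `p`, `q` the products of `v`, `w`: `∫ |p| = t ∫ sign(q) p ≤ ∫ sign(q) p`, whereas `sign(q)
  -- p ≤ |p|` pointwise. So equality holds almost everywhere.
  have h4 : ∫ x, (Real.sign (wedgeProd v x) * wedgeProd v x -
      Real.sign (wedgeProd w x) * wedgeProd v x) ∂arcMeasure ≤ 0 := by
    rw [integral_sub (integrable_sign_mul (continuous_wedgeProd v) (continuous_wedgeProd v))
      (integrable_sign_mul (continuous_wedgeProd w) (continuous_wedgeProd v)), h1, h2]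
    have h5 : 0 < ∑ i, a i * tupleMoment w i := by
      rw [h3] at hpos
      exact (mul_pos_iff_of_pos_left ht).mp hpos
    rw [h3]
    nlinarith
  have h5 := (integral_eq_zero_iff_of_nonneg hnn hint).mp
    (le_antisymm h4 (integral_nonneg hnn))
  refine signRegion_eq_of_nonneg fun x => ?_
  by_contra! hx
  have hO : IsOpen {y | wedgeProd w y * wedgeProd v y < 0} :=
    isOpen_lt ((continuous_wedgeProd w).mul (continuous_wedgeProd v)) continuous_const
  -- The set where the two products have opposite signs is open; if nonempty it would have positive
  -- measure, yet equality fails throughout it.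
  refine (hO.measure_pos arcMeasure ⟨x, hx⟩).ne' (measure_mono_null ?_ (ae_iff.mp h5))
  intro y hy
  have hy' : wedgeProd w y * wedgeProd v y < 0 := hy
  simp only [Set.mem_ofPred_eq, Pi.zero_apply]
  rcases mul_neg_iff.mp hy' with ⟨h6, h7⟩ | ⟨h6, h7⟩
  · rw [Real.sign_of_pos h6, Real.sign_of_neg h7]
    intro h8
    linarith
  · rw [Real.sign_of_neg h6, Real.sign_of_pos h7]
    intro h8
    linarith

/-! ### The gradient of the `L¹` norm and the directions of the moments -/

lemma continuous_integral_abs_formComb {N : ℕ} :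
    Continuous fun a : Fin N → ℝ => ∫ x, |formComb a x| ∂arcMeasure := by
  have : Continuous (Function.uncurry fun (a : Fin N → ℝ) (x : Circ) => |formComb a x|) := by
    refine Continuous.abs (continuous_finsetSum _ fun i _ => ?_)
    exact ((continuous_apply i).comp continuous_fst).mul
      ((continuous_formBasis i).comp continuous_snd)
  simpa using continuous_parametric_integral_of_continuous (μ := arcMeasure) this isCompact_univ

lemma formComb_add_smul {N : ℕ} (a b : Fin N → ℝ) (s : ℝ) (x : Circ) :
    formComb (a + s • b) x = formComb a x + s * formComb b x := by
  simp only [formComb, Pi.add_apply, Pi.smul_apply, smul_eq_mul, Finset.mul_sum,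
    ← Finset.sum_add_distrib]
  exact Finset.sum_congr rfl fun i _ => by ring

lemma formComb_smul {N : ℕ} (a : Fin N → ℝ) (s : ℝ) (x : Circ) :
    formComb (s • a) x = s * formComb a x := by
  simp only [formComb, Pi.smul_apply, smul_eq_mul, Finset.mul_sum]
  exact Finset.sum_congr rfl fun i _ => by ring

/-- The integrand is Lipschitz in `s` with constant `|q x|` and differentiable at `0` wherever `p x
≠ 0`, hence almost everywhere. Thus the moments of a sign are the partial derivatives of an `L¹`
norm. -/
lemma hasDerivAt_integral_abs {p q : Circ → ℝ} (hp : Continuous p) (hq : Continuous q)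
    (hp0 : {x | p x = 0}.Finite) :
    HasDerivAt (fun s : ℝ => ∫ x, |p x + s * q x| ∂arcMeasure)
      (∫ x, Real.sign (p x) * q x ∂arcMeasure) 0 := by
  refine (hasDerivAt_integral_of_dominated_loc_of_lip (F := fun s x => |p x + s * q x|)
    (bound := fun x => |q x|) (s := Set.univ) Filter.univ_mem ?_ ?_ ?_ ?_ ?_ ?_).2
  · exact Filter.Eventually.of_forall fun s =>
      (hp.add (continuous_const.mul hq)).abs.aestronglyMeasurable
  · exact integrable_of_continuous (hp.add (continuous_const.mul hq)).abs
  · exact (integrable_sign_mul hp hq).aestronglyMeasurable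
  · refine Filter.Eventually.of_forall fun x => ?_
    refine LipschitzWith.lipschitzOnWith (LipschitzWith.of_dist_le_mul fun s t => ?_)
    rw [Real.dist_eq, Real.dist_eq, Real.coe_nnabs, abs_abs]
    refine (abs_abs_sub_abs_le _ _).trans (le_of_eq ?_)
    rw [← abs_mul]
    congr 1
    ring
  · exact (integrable_of_continuous hq).abs
  · filter_upwards [ae_ne_zero_of_finite hp0] with x hx
    have h1 : HasDerivAt (fun s : ℝ => p x + s * q x) (q x) 0 := by
      simpa using ((hasDerivAt_id (0 : ℝ)).mul_const (q x)).const_add (p x)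
    have h2 : HasDerivAt (fun r : ℝ => |r|) (Real.sign (p x)) (p x + 0 * q x) := by
      rw [zero_mul, add_zero]
      rcases hx.lt_or_gt with h | h
      · rw [Real.sign_of_neg h]; exact hasDerivAt_abs_neg h
      · rw [Real.sign_of_pos h]; exact hasDerivAt_abs_pos h
    exact h2.comp (0 : ℝ) h1

/-- Every vector is a positive multiple of the moments of a `2 n + 1`-tuple. -/
theorem exists_tupleMoment_eq {n : ℕ} {c : Fin (2 * n + 2) → ℝ} (hc : c ≠ 0) :
    ∃ v : Fin (2 * n + 1) → Circ, ∃ t : ℝ, 0 < t ∧ ∀ i, c i = t * tupleMoment v i := by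
  -- A Lagrange multiplier argument: the functional `ψ` with coefficients `c` is maximised relative
  -- to the `L¹` norm `φ`, and the maximal ratio `M` becomes `t`.
  let φ : (Fin (2 * n + 2) → ℝ) → ℝ := fun a => ∫ x, |formComb a x| ∂arcMeasure
  let ψ : (Fin (2 * n + 2) → ℝ) → ℝ := fun a => ∑ i, a i * c i
  have hφc : Continuous φ := continuous_integral_abs_formComb
  have hψc : Continuous ψ :=
    continuous_finsetSum _ fun i _ => (continuous_apply i).mul continuous_const
  have hφpos : ∀ a, a ≠ 0 → 0 < φ a := fun a ha =>
    integral_abs_pos (continuous_formComb a) (formComb_ne_zero ha)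
  have hφs : ∀ (s : ℝ) a, 0 ≤ s → φ (s • a) = s * φ a := by
    intro s a hs
    simp only [φ, formComb_smul, abs_mul, abs_of_nonneg hs]
    rw [integral_const_mul]
  have hψs : ∀ (s : ℝ) a, ψ (s • a) = s * ψ a := by
    intro s a
    simp only [ψ, Pi.smul_apply, smul_eq_mul, Finset.mul_sum]
    exact Finset.sum_congr rfl fun i _ => by ring
  have hne : ∀ a ∈ Metric.sphere (0 : Fin (2 * n + 2) → ℝ) 1, a ≠ 0 := by
    rintro a ha rfl
    simp at ha
  obtain ⟨a, ha, hmax⟩ := (isCompact_sphere (0 : Fin (2 * n + 2) → ℝ) 1).exists_isMaxOn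
    (NormedSpace.sphere_nonempty.mpr zero_le_one) (f := fun a => ψ a / φ a)
    (hψc.continuousOn.div hφc.continuousOn fun a ha => (hφpos a (hne a ha)).ne')
  set M := ψ a / φ a with hM
  have ha0 := hne a ha
  have hle : ∀ b, ψ b ≤ M * φ b := by
    intro b
    rcases eq_or_ne b 0 with rfl | hb
    · have h0 := hφs 0 0 le_rfl
      have h1 := hψs 0 0
      rw [zero_smul, zero_mul] at h0 h1
      rw [h0, h1, mul_zero]
    · have hb' : 0 < ‖b‖ := norm_pos_iff.mpr hb
      have := hmax (show ‖b‖⁻¹ • b ∈ Metric.sphere (0 : Fin (2 * n + 2) → ℝ) 1 by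
        rw [mem_sphere_zero_iff_norm, norm_smul, norm_inv, norm_norm, inv_mul_cancel₀ hb'.ne'])
      have h2 : ψ (‖b‖⁻¹ • b) / φ (‖b‖⁻¹ • b) ≤ M := this
      rw [hψs, hφs _ _ (inv_pos.mpr hb').le, mul_div_mul_left _ _ (inv_pos.mpr hb').ne',
        div_le_iff₀ (hφpos b hb)] at h2
      exact h2
  have hMpos : 0 < M := by
    have h1 := hle c
    have h2 : 0 < ψ c := by
      obtain ⟨i, hi⟩ := Function.ne_iff.mp hc
      exact Finset.sum_pos' (fun j _ => mul_self_nonneg _) ⟨i, Finset.mem_univ i, mul_self_pos.mpr hi⟩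
    by_contra! h
    have := mul_nonpos_of_nonpos_of_nonneg h (hφpos c hc).le
    linarith
  have heq : ψ a = M * φ a := by rw [hM, div_mul_cancel₀ _ (hφpos a ha0).ne']
  -- The sign of the maximising form is realised by a tuple, and this is the required one.
  obtain ⟨v, hv⟩ := exists_wedgeProd_sign ⟨n, rfl⟩ (formComb_mem n a) (formComb_ne_zero ha0)
  have hfin : {x | formComb a x = 0}.Finite := by
    refine (finite_wedgeProd_zeros v).subset fun x (hx : formComb a x = 0) => ?_
    by_contra h
    have := hv x h
    rw [hx, zero_mul] at this
    exact this.false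
  refine ⟨v, M, hMpos, fun i => ?_⟩
  have hsv : tupleMoment v i = ∫ x, Real.sign (formComb a x) * formBasis i x ∂arcMeasure := by
    refine integral_congr_ae ?_
    filter_upwards [ae_wedgeProd_ne v] with x hx
    have h := hv x hx
    rcases mul_pos_iff.mp h with ⟨h1, h2⟩ | ⟨h1, h2⟩
    · rw [Real.sign_of_pos h1, Real.sign_of_pos h2]
    · rw [Real.sign_of_neg h1, Real.sign_of_neg h2]
  have hb : ∀ x, formComb (Pi.single i (1 : ℝ)) x = formBasis i x := by
    intro x
    simp [formComb, Pi.single_apply]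
  have hder := hasDerivAt_integral_abs (continuous_formComb a) (continuous_formBasis i) hfin
  have hF : HasDerivAt (fun s : ℝ => M * (∫ x, |formComb a x + s * formBasis i x| ∂arcMeasure) -
      (ψ a + s * c i)) (M * tupleMoment v i - c i) 0 := by
    rw [hsv]
    refine (hder.const_mul M).sub ?_
    simpa using ((hasDerivAt_id (0 : ℝ)).mul_const (c i)).const_add (ψ a)
  -- Since `M φ - ψ` is nonnegative and zero at `a`, its derivative at `a` in the direction of each
  -- basis form vanishes.
  have hmin : IsLocalMin (fun s : ℝ => M * (∫ x, |formComb a x + s * formBasis i x| ∂arcMeasure) -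
      (ψ a + s * c i)) 0 := by
    refine Filter.Eventually.of_forall fun s => ?_
    have h1 := hle (a + s • Pi.single i (1 : ℝ))
    have h2 : ψ (a + s • Pi.single i (1 : ℝ)) = ψ a + s * c i := by
      simp only [ψ, Pi.add_apply, Pi.smul_apply, smul_eq_mul, add_mul, Finset.sum_add_distrib]
      simp [Pi.single_apply]
    simp only [φ, formComb_add_smul, hb] at h1
    rw [h2] at h1
    have h3 : M * (∫ x, |formComb a x| ∂arcMeasure) = ψ a := heq.symm
    simp only [zero_mul, add_zero]
    rw [h3]
    linarith
  have := hmin.hasDerivAt_eq_zero hF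
  linarith

/-! ### The topology of the configuration space -/

namespace MaxtameSpace

lemma continuous_ofTuple {l : ℕ} (hl : Odd l) : Continuous (ofTuple hl) := by
  have h1 : Continuous (toMaxtame l) :=
    continuous_iSup_rng (i := l) (continuous_iSup_rng (i := hl) continuous_coinduced_rng)
  have h2 : Continuous fun v : Fin l → Circ =>
      (⟨v, isMaxtame_signRegion hl v⟩ : {v : Fin l → Circ // IsMaxtame (signRegion v)}) :=
    continuous_id.subtype_mk _
  have h3 : ofTuple hl = toMaxtame l ∘ fun v => ⟨v, isMaxtame_signRegion hl v⟩ := rfl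
  rw [h3]
  exact Continuous.comp h1 h2

lemma continuous_dom {Y : Type*} [TopologicalSpace Y] {f : MaxtameSpace → Y}
    (h : ∀ (l : ℕ) (hl : Odd l), Continuous fun v => f (ofTuple hl v)) : Continuous f := by
  refine continuous_iSup_dom.mpr fun l => continuous_iSup_dom.mpr fun hl => ?_
  rw [continuous_coinduced_dom]
  exact (h l hl).comp continuous_subtype_val

/-- Appending an even number of copies of one vector multiplies the product by a nonnegative
function. -/
lemma exists_pad {n N : ℕ} (h : n ≤ N) (v : Fin (2 * n + 1) → Circ) :
    ∃ w : Fin (2 * N + 1) → Circ, signRegion w = signRegion v := by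
  obtain ⟨k, rfl⟩ := Nat.exists_eq_add_of_le h
  let a : Circ := mk 1 0 (by norm_num)
  have hcast : 2 * n + 1 + 2 * k = 2 * (n + k) + 1 := by ring
  rw [← hcast]
  refine ⟨Fin.append v fun _ : Fin (2 * k) => a, signRegion_eq_of_nonneg fun x => ?_⟩
  rw [wedgeProd_append]
  have h1 : wedgeProd (fun _ : Fin (2 * k) => a) x = wedge a x ^ (2 * k) := by simp [wedgeProd]
  rw [h1, ← mul_assoc]
  exact mul_nonneg (mul_self_nonneg _) ((even_two_mul k).pow_nonneg _)

/-- Every maxtame set comes from a `2 N + 1`-tuple, for all large `N`. -/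
lemma exists_ofTuple_of_le (U : MaxtameSpace) :
    ∃ n, ∀ N, n ≤ N → ∃ w : Fin (2 * N + 1) → Circ, ofTuple (odd_two_mul_add_one N) w = U := by
  obtain ⟨l, ⟨n, rfl⟩, v, rfl⟩ := exists_ofTuple U
  refine ⟨n, fun N hN => ?_⟩
  obtain ⟨w, hw⟩ := exists_pad hN v
  exact ⟨w, Subtype.ext hw⟩

end MaxtameSpace

lemma tupleMoment_congr {n N : ℕ} {v : Fin (2 * n + 1) → Circ} {w : Fin (2 * N + 1) → Circ}
    (h : signRegion v = signRegion w) : tupleMoment v = tupleMoment w := by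
  rw [← MaxtameSpace.moment_ofTuple (odd_two_mul_add_one n), ← MaxtameSpace.moment_ofTuple (odd_two_mul_add_one N)]
  congr 1
  exact Subtype.ext h

/-! ### The cone over the moments -/

/-- The cone over the space of `2 n + 1`-tuples, mapped by its first `2 n + 2` moments. -/
noncomputable def momentCone (n : ℕ) (p : NNReal × (Fin (2 * n + 1) → Circ)) :
    Fin (2 * n + 2) → ℝ := fun j => p.1 * tupleMoment p.2 j

lemma continuous_momentCone (n : ℕ) : Continuous (momentCone n) := by
  refine continuous_pi fun j => ?_
  exact (NNReal.continuous_coe.comp continuous_fst).mul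
    ((continuous_tupleMoment j).comp continuous_snd)

lemma surjective_momentCone (n : ℕ) : Function.Surjective (momentCone n) := by
  intro c
  rcases eq_or_ne c 0 with rfl | hc
  · exact ⟨(0, fun _ => mk 1 0 (by norm_num)), by ext j; simp [momentCone]⟩
  · obtain ⟨v, t, ht, h⟩ := exists_tupleMoment_eq hc
    exact ⟨(⟨t, ht.le⟩, v), funext fun j => (h j).symm⟩

/-- The norm of the moment vector has a positive minimum on the compact torus, so bounded values
bound the cone parameter. -/
lemma isProperMap_momentCone (n : ℕ) : IsProperMap (momentCone n) := by
  rw [isProperMap_iff_isCompact_preimage]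
  refine ⟨continuous_momentCone n, fun K hK => ?_⟩
  let f : (Fin (2 * n + 1) → Circ) → ℝ := fun v => ‖fun j : Fin (2 * n + 2) => tupleMoment v j‖
  have hf : Continuous f :=
    continuous_norm.comp (continuous_pi fun j => continuous_tupleMoment (j : ℕ))
  obtain ⟨v₀, -, hv₀⟩ := isCompact_univ.exists_isMinOn
    (⟨fun _ => mk 1 0 (by norm_num), Set.mem_univ _⟩ :
      (Set.univ : Set (Fin (2 * n + 1) → Circ)).Nonempty) hf.continuousOn
  have hpos : 0 < f v₀ := by
    obtain ⟨i, hi, h⟩ := exists_tupleMoment_ne_zero v₀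
    refine norm_pos_iff.mpr fun h0 => h (congrFun h0 ⟨i, hi⟩)
  obtain ⟨R, hR⟩ := hK.isBounded.exists_norm_le
  refine IsCompact.of_isClosed_subset
    ((isCompact_Icc (a := (0 : NNReal)) (b := (R / f v₀).toNNReal)).prod isCompact_univ)
    (hK.isClosed.preimage (continuous_momentCone n)) ?_
  rintro ⟨t, v⟩ htv
  refine ⟨⟨zero_le, ?_⟩, Set.mem_univ _⟩
  have h1 := hR _ htv
  have h2 : momentCone n (t, v) = (t : ℝ) • fun j : Fin (2 * n + 2) => tupleMoment v j := rfl
  rw [h2, norm_smul, NNReal.norm_eq] at h1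
  have h3 : f v₀ ≤ f v := hv₀ (Set.mem_univ v)
  refine NNReal.le_toNNReal_of_coe_le ?_
  rw [le_div_iff₀ hpos]
  exact (mul_le_mul_of_nonneg_left h3 t.2).trans h1

/-- Away from the vertex, proportional moment vectors give the same region, hence the same moments
of every order and the same cone parameter. This lets the higher moments descend along `momentCone`.
-/
lemma momentCone_eq {n : ℕ} {t s : NNReal} {v w : Fin (2 * n + 1) → Circ}
    (h : momentCone n (t, v) = momentCone n (s, w)) (i : ℕ) :
    t * tupleMoment v i = s * tupleMoment w i := by
  have hj : ∀ j < 2 * n + 2, (t : ℝ) * tupleMoment v j = s * tupleMoment w j :=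
    fun j hj => congrFun h ⟨j, hj⟩
  rcases eq_or_ne t 0 with rfl | ht
  · obtain ⟨j, hj1, hj2⟩ := exists_tupleMoment_ne_zero w
    have h1 := hj j hj1
    rw [NNReal.coe_zero, zero_mul, zero_eq_mul, or_iff_left hj2] at h1
    rw [h1, NNReal.coe_zero, zero_mul, zero_mul]
  · have ht' : (0 : ℝ) < t := NNReal.coe_pos.mpr (pos_iff_ne_zero.mpr ht)
    obtain ⟨j, hj1, hj2⟩ := exists_tupleMoment_ne_zero v
    have hs' : (0 : ℝ) < s := by
      refine lt_of_le_of_ne s.2 fun h0 => ?_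
      have h1 := hj j hj1
      rw [← h0, zero_mul, mul_eq_zero] at h1
      exact h1.elim ht'.ne' hj2
    have hreg : signRegion v = signRegion w := by
      refine signRegion_eq_of_tupleMoment (t := s / t) (div_pos hs' ht') fun j hj' => ?_
      rw [div_mul_eq_mul_div, eq_div_iff ht'.ne', mul_comm, hj j hj']
    have hm := tupleMoment_congr hreg
    have hts : (t : ℝ) = s := by
      have h1 := hj j hj1
      rw [← hm] at h1
      exact mul_right_cancel₀ hj2 h1
    rw [hm, hts]

/-- The higher moments of `2 n + 1`-tuples are continuous functions, homogeneous of degree one, of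
the first `2 n + 2` moments. -/
lemma exists_momentExt (n i : ℕ) : ∃ G : (Fin (2 * n + 2) → ℝ) → ℝ, Continuous G ∧
    ∀ p, G (momentCone n p) = p.1 * tupleMoment p.2 i := by
  -- A closed continuous surjection is a quotient map, so the factored function is automatically
  -- continuous, at the vertex too.
  have hq : Topology.IsQuotientMap (momentCone n) :=
    (isProperMap_momentCone n).isClosedMap.isQuotientMap (continuous_momentCone n)
      (surjective_momentCone n)
  let g : C(NNReal × (Fin (2 * n + 1) → Circ), ℝ) :=
    ⟨fun p => p.1 * tupleMoment p.2 i, (NNReal.continuous_coe.comp continuous_fst).mul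
      ((continuous_tupleMoment i).comp continuous_snd)⟩
  have hg : Function.FactorsThrough g (momentCone n) := fun _ _ h => momentCone_eq h i
  refine ⟨fun c => g (Function.surjInv (surjective_momentCone n) c), ?_, fun p => ?_⟩
  · rw [hq.continuous_iff]
    convert g.continuous using 1
    ext p
    exact hg (Function.surjInv_eq (surjective_momentCone n) _)
  · exact hg (Function.surjInv_eq (surjective_momentCone n) _)

/-- The `i`-th moment of `2 n + 1`-tuples as a function of the first `2 n + 2` moments. -/
noncomputable def momentExt (n i : ℕ) : (Fin (2 * n + 2) → ℝ) → ℝ := (exists_momentExt n i).choose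

lemma continuous_momentExt (n i : ℕ) : Continuous (momentExt n i) :=
  (exists_momentExt n i).choose_spec.1

lemma momentExt_momentCone (n i : ℕ) (p : NNReal × (Fin (2 * n + 1) → Circ)) :
    momentExt n i (momentCone n p) = p.1 * tupleMoment p.2 i :=
  (exists_momentExt n i).choose_spec.2 p

lemma momentExt_tupleMoment {n : ℕ} (i : ℕ) (v : Fin (2 * n + 1) → Circ) :
    momentExt n i (fun j => tupleMoment v j) = tupleMoment v i := by
  have h := momentExt_momentCone n i (1, v)
  rw [show momentCone n (1, v) = fun j : Fin (2 * n + 2) => tupleMoment v j by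
    ext j; simp [momentCone]] at h
  simpa using h

lemma momentExt_smul (n i : ℕ) {t : ℝ} (ht : 0 ≤ t) (c : Fin (2 * n + 2) → ℝ) :
    momentExt n i (fun j => t * c j) = t * momentExt n i c := by
  obtain ⟨⟨s, v⟩, rfl⟩ := surjective_momentCone n c
  lift t to NNReal using ht
  have h : (fun j => t * momentCone n (s, v) j) = momentCone n (t * s, v) := by
    ext j
    simp [momentCone, mul_assoc]
  rw [h, momentExt_momentCone, momentExt_momentCone]
  simp [mul_assoc]

/-! ### The shear of the moment space -/

/-- The homeomorphism of the sequence space that subtracts from each pair of coordinates the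
value prescribed by the preceding ones. -/
noncomputable def shear (c : ℕ → ℝ) (i : ℕ) : ℝ :=
  -- Index `i` belongs to the pair starting at `2 (i / 2)`. The level `i / 2 - 1` uses exactly the
  -- coordinates preceding that pair, hence the system is triangular.
  if i < 2 then c i else c i - momentExt (i / 2 - 1) i fun j => c j

lemma continuous_shear (i : ℕ) : Continuous fun c : ℕ → ℝ => shear c i := by
  unfold shear
  split_ifs
  · exact continuous_apply i
  · exact (continuous_apply i).sub ((continuous_momentExt _ _).comp
      (continuous_pi fun j => continuous_apply _))

/-- The inverse of `shear`. -/
noncomputable def unshear (y : ℕ → ℝ) (i : ℕ) : ℝ :=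
  if _h : i < 2 then y i
  else y i + momentExt (i / 2 - 1) i fun j => unshear y j
termination_by i
decreasing_by
  have := j.2
  omega

lemma shear_unshear (y : ℕ → ℝ) : shear (unshear y) = y := by
  ext i
  rw [shear]
  split_ifs with h
  · rw [unshear, dif_pos h]
  · conv_lhs => enter [1]; rw [unshear, dif_neg h]
    ring

/-- Triangularity and homogeneity of `momentExt` allow strong induction on the index. The case `t =
0` serves to show that vanishing sheared coordinates force vanishing moments. -/
lemma eq_smul_of_shear_eq {c c' : ℕ → ℝ} {t : ℝ} (ht : 0 ≤ t) {n : ℕ}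
    (h : ∀ i < n, shear c i = t * shear c' i) :
    ∀ i < n, c i = t * c' i := by
  intro i
  induction i using Nat.strong_induction_on with
  | _ i ih =>
    intro hi
    have h1 := h i hi
    unfold shear at h1
    split_ifs at h1 with h2
    · exact h1
    · have h3 : (fun j : Fin (2 * (i / 2 - 1) + 2) => c j) = fun j : Fin _ => t * c' j := by
        ext j
        have := j.2
        exact ih j (by omega) (by omega)
      rw [h3, momentExt_smul _ _ ht] at h1
      linarith

lemma shear_smul_of_eq {c c' : ℕ → ℝ} {t : ℝ} (ht : 0 ≤ t) {n : ℕ}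
    (h : ∀ i < n, c i = t * c' i) : ∀ i < n, shear c i = t * shear c' i := by
  intro i hi
  unfold shear
  split_ifs with h2
  · exact h i hi
  · have h3 : (fun j : Fin (2 * (i / 2 - 1) + 2) => c j) = fun j : Fin _ => t * c' j := by
      ext j
      have := j.2
      exact h j (by omega)
    rw [h3, momentExt_smul _ _ ht, h i hi]
    ring

/-- The sheared moments vanish beyond the level of the tuple. -/
lemma shear_tupleMoment_eq_zero {n : ℕ} (v : Fin (2 * n + 1) → Circ) {i : ℕ}
    (hi : 2 * n + 2 ≤ i) : shear (tupleMoment v) i = 0 := by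
  -- Padding to the level used by coordinate `i` makes the subtracted prediction equal to the `i`-th
  -- moment.
  obtain ⟨w, hw⟩ := MaxtameSpace.exists_pad (show n ≤ i / 2 - 1 by omega) v
  rw [← tupleMoment_congr hw, shear, if_neg (by omega), momentExt_tupleMoment, sub_self]

lemma exists_shear_tupleMoment_ne_zero {n : ℕ} (v : Fin (2 * n + 1) → Circ) :
    ∃ i < 2 * n + 2, shear (tupleMoment v) i ≠ 0 := by
  by_contra! h
  obtain ⟨i, hi, hi'⟩ := exists_tupleMoment_ne_zero v
  apply hi'
  rw [eq_smul_of_shear_eq (c := tupleMoment v) (c' := 0) le_rfl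
    (fun j hj => by rw [h j hj, zero_mul]) i hi, zero_mul]

/-- Every nonzero vector with `2 n + 2` coordinates is a positive multiple of the sheared moments
of a `2 n + 1`-tuple. -/
lemma exists_eq_smul_shear {n : ℕ} {y : ℕ → ℝ} (hy : ∀ i, 2 * n + 2 ≤ i → y i = 0)
    (hy0 : ∃ i, y i ≠ 0) :
    ∃ v : Fin (2 * n + 1) → Circ, ∃ t : ℝ, 0 < t ∧ ∀ i, y i = t * shear (tupleMoment v) i := by
  obtain ⟨i, hi⟩ := hy0
  -- If the first `2n+2` unsheared coordinates vanished, shearing them back would give `y = 0`.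
  have hc : (fun j : Fin (2 * n + 2) => unshear y j) ≠ 0 := by
    intro h0
    apply hi
    rcases lt_or_ge i (2 * n + 2) with h | h
    · have := shear_smul_of_eq (c := unshear y) (c' := 0) le_rfl (n := 2 * n + 2)
        (fun j hj => by rw [zero_mul]; exact congrFun h0 ⟨j, hj⟩) i h
      rwa [shear_unshear, zero_mul] at this
    · exact hy i h
  obtain ⟨v, t, ht, h⟩ := exists_tupleMoment_eq hc
  refine ⟨v, t, ht, fun j => ?_⟩
  rcases lt_or_ge j (2 * n + 2) with hj | hj
  · rw [← shear_smul_of_eq ht.le (c := unshear y) (fun j hj => h ⟨j, hj⟩) j hj, shear_unshear]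
  · rw [hy j hj, shear_tupleMoment_eq_zero v hj, mul_zero]

/-! ### The infinite sphere -/

namespace InfiniteSphere

lemma sphereIncl_apply_of_lt {n i : ℕ} (x : USphere (n + 1)) (hi : i < n + 1) :
    (sphereIncl n x).1 i = x.1 ⟨i, hi⟩ :=
  Finsupp.mapDomain_apply Fin.val_injective (Finsupp.equivFunOnFinite.symm fun i => x.1 i)
    (⟨i, hi⟩ : Fin (n + 1))

lemma sphereIncl_apply_of_ge {n i : ℕ} (x : USphere (n + 1)) (hi : n + 1 ≤ i) :
    (sphereIncl n x).1 i = 0 := by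
  refine Finsupp.mapDomain_of_notMem_range _ _ ?_
  rintro ⟨j, rfl⟩
  exact absurd j.2 (not_lt.mpr hi)

lemma eq_of_forall_eq_mul {p q : InfiniteSphere} {t : ℝ} (ht : 0 < t)
    (h : ∀ i, p.1 i = t * q.1 i) : p = q := by
  have hpq : p.1 = t • q.1 := Finsupp.ext fun i => h i
  have h1 := p.2
  rw [hpq, Finsupp.sum_smul_index' (by simp)] at h1
  simp only [smul_eq_mul, mul_pow] at h1
  rw [← Finsupp.mul_sum, q.2, mul_one] at h1
  have ht1 : t = 1 := (pow_eq_one_iff_of_nonneg ht.le two_ne_zero).mp h1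
  apply Subtype.ext
  rw [hpq, ht1, one_smul]

lemma exists_ne_zero (p : InfiniteSphere) : ∃ i, p.1 i ≠ 0 := by
  by_contra! h
  have h1 := p.2
  rw [show p.1 = 0 from Finsupp.ext h, Finsupp.sum_zero_index] at h1
  exact zero_ne_one h1

/-- The first coordinates of a point of the infinite sphere. -/
noncomputable def restrict (n : ℕ) (p : InfiniteSphere) (hp : ∀ i, n + 1 ≤ i → p.1 i = 0) :
    USphere (n + 1) :=
  ⟨WithLp.toLp 2 fun i => p.1 i, by
    rw [mem_sphere_zero_iff_norm, EuclideanSpace.norm_eq, Real.sqrt_eq_one]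
    refine Eq.trans ?_ p.2
    rw [Finsupp.sum_of_support_subset p.1 (s := Finset.range (n + 1)) ?_ _ (by simp),
      Finset.sum_range]
    · simp
    · intro i hi
      rw [Finset.mem_range]
      by_contra! h
      exact Finsupp.mem_support_iff.mp hi (hp i h)⟩

lemma sphereIncl_restrict (n : ℕ) (p : InfiniteSphere) (hp : ∀ i, n + 1 ≤ i → p.1 i = 0) :
    sphereIncl n (restrict n p hp) = p := by
  apply Subtype.ext
  ext i
  rcases lt_or_ge i (n + 1) with h | h
  · rw [sphereIncl_apply_of_lt _ h]; rfl
  · rw [sphereIncl_apply_of_ge _ h, hp i h]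

lemma exists_bound (p : InfiniteSphere) : ∃ n, ∀ i, n ≤ i → p.1 i = 0 := by
  obtain ⟨n, hn⟩ := p.1.support.bddAbove
  refine ⟨n + 1, fun i hi => ?_⟩
  by_contra h
  have := hn (Finsupp.mem_support_iff.mpr h)
  omega

lemma continuous_sphereIncl (n : ℕ) : Continuous (sphereIncl n) :=
  continuous_iSup_rng (i := n) continuous_coinduced_rng

/-- Continuity may be tested on the odd dimensional spheres. -/
lemma continuous_dom {Y : Type*} [TopologicalSpace Y] {f : InfiniteSphere → Y}
    (h : ∀ n : ℕ, Continuous fun x => f (sphereIncl (2 * n + 1) x)) : Continuous f := by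
  refine continuous_iSup_dom.mpr fun n => ?_
  rw [continuous_coinduced_dom]
  -- The odd spheres are cofinal: `S^n` embeds in `S^(2n+1)` by zeros.
  let ι : USphere (n + 1) → USphere (2 * n + 1 + 1) := fun x =>
    restrict (2 * n + 1) (sphereIncl n x) fun i hi => sphereIncl_apply_of_ge x (by omega)
  have hι : Continuous ι := by
    refine Continuous.subtype_mk ?_ _
    refine (PiLp.continuous_toLp 2 _).comp (continuous_pi fun i => ?_)
    rcases lt_or_ge (i : ℕ) (n + 1) with h | h
    · simp only [sphereIncl_apply_of_lt _ h]
      fun_prop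
    · simp only [sphereIncl_apply_of_ge _ h]
      exact continuous_const
  convert (h n).comp hι using 1
  ext x
  simp only [Function.comp_apply, ι, sphereIncl_restrict]

end InfiniteSphere

/-! ### The homeomorphism with the infinite sphere -/

/-- The normalised sheared moments of a `2 n + 1`-tuple. -/
noncomputable def momentSphere (n : ℕ) (v : Fin (2 * n + 1) → Circ) : USphere (2 * n + 1 + 1) :=
  ⟨‖WithLp.toLp 2 fun i : Fin (2 * n + 1 + 1) => shear (tupleMoment v) i‖⁻¹ •
      WithLp.toLp 2 fun i : Fin (2 * n + 1 + 1) => shear (tupleMoment v) i, by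
    obtain ⟨i, hi, h⟩ := exists_shear_tupleMoment_ne_zero v
    rw [mem_sphere_zero_iff_norm, norm_smul, norm_inv, norm_norm, inv_mul_cancel₀]
    rw [norm_ne_zero_iff]
    intro h0
    apply h
    exact congrArg (fun y : EuclideanSpace ℝ (Fin (2 * n + 1 + 1)) => y ⟨i, hi⟩) h0⟩

/-- The truncation loses nothing, because sheared moments vanish beyond the level. Hence the image
in the infinite sphere depends only on the region and not on `n`. -/
lemma sphereIncl_momentSphere {n : ℕ} (v : Fin (2 * n + 1) → Circ) :
    ∃ t : ℝ, 0 < t ∧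
      ∀ i, (sphereIncl (2 * n + 1) (momentSphere n v)).1 i = t * shear (tupleMoment v) i := by
  obtain ⟨i, hi, h⟩ := exists_shear_tupleMoment_ne_zero v
  refine ⟨‖WithLp.toLp 2 fun i : Fin (2 * n + 1 + 1) => shear (tupleMoment v) i‖⁻¹, ?_, ?_⟩
  · rw [inv_pos, norm_pos_iff]
    intro h0
    apply h
    exact congrArg (fun y : EuclideanSpace ℝ (Fin (2 * n + 1 + 1)) => y ⟨i, hi⟩) h0
  · intro j
    rcases lt_or_ge j (2 * n + 1 + 1) with hj | hj
    · rw [InfiniteSphere.sphereIncl_apply_of_lt _ hj]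
      rfl
    · rw [InfiniteSphere.sphereIncl_apply_of_ge _ hj, shear_tupleMoment_eq_zero v hj, mul_zero]

lemma continuous_momentSphere (n : ℕ) : Continuous (momentSphere n) := by
  refine Continuous.subtype_mk ?_ _
  have h1 : Continuous fun v : Fin (2 * n + 1) → Circ =>
      WithLp.toLp 2 fun i : Fin (2 * n + 1 + 1) => shear (tupleMoment v) i :=
    (PiLp.continuous_toLp 2 _).comp (continuous_pi fun i =>
      (continuous_shear i).comp (continuous_pi fun j => continuous_tupleMoment j))
  refine (Continuous.inv₀ h1.norm fun v => ?_).smul h1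
  obtain ⟨i, hi, h⟩ := exists_shear_tupleMoment_ne_zero v
  rw [norm_ne_zero_iff]
  intro h0
  apply h
  exact congrArg (fun y : EuclideanSpace ℝ (Fin (2 * n + 1 + 1)) => y ⟨i, hi⟩) h0

lemma surjective_momentSphere (n : ℕ) : Function.Surjective (momentSphere n) := by
  intro y
  obtain ⟨v, t, ht, h⟩ := exists_eq_smul_shear (n := n) (y := (sphereIncl (2 * n + 1) y).1)
    (fun i hi => InfiniteSphere.sphereIncl_apply_of_ge y hi) (InfiniteSphere.exists_ne_zero _)
  obtain ⟨s, hs, h'⟩ := sphereIncl_momentSphere v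
  refine ⟨v, ?_⟩
  have heq : sphereIncl (2 * n + 1) (momentSphere n v) = sphereIncl (2 * n + 1) y :=
    InfiniteSphere.eq_of_forall_eq_mul (div_pos hs ht) fun i => by
      rw [h', h]
      field_simp
  apply Subtype.ext
  ext i
  rw [← InfiniteSphere.sphereIncl_apply_of_lt _ i.2, heq, InfiniteSphere.sphereIncl_apply_of_lt _ i.2]

/-- A continuous surjection from a compact torus to a Hausdorff space is closed. -/
lemma isQuotientMap_momentSphere (n : ℕ) : Topology.IsQuotientMap (momentSphere n) :=
  (continuous_momentSphere n).isClosedMap.isQuotientMap (continuous_momentSphere n)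
    (surjective_momentSphere n)

namespace MaxtameSpace

lemma exists_infiniteSphere (U : MaxtameSpace) : ∃ p : InfiniteSphere, ∃ t : ℝ, 0 < t ∧
    ∀ i, p.1 i = t * shear (moment U) i := by
  obtain ⟨n, hn⟩ := exists_ofTuple_of_le U
  obtain ⟨v, rfl⟩ := hn n le_rfl
  rw [moment_ofTuple]
  exact ⟨_, sphereIncl_momentSphere v⟩

/-- The point of the infinite sphere in the direction of the sheared moments. -/
noncomputable def toInfiniteSphere (U : MaxtameSpace) : InfiniteSphere :=
  (exists_infiniteSphere U).choose

lemma toInfiniteSphere_spec (U : MaxtameSpace) : ∃ t : ℝ, 0 < t ∧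
    ∀ i, (toInfiniteSphere U).1 i = t * shear (moment U) i :=
  (exists_infiniteSphere U).choose_spec

lemma toInfiniteSphere_ofTuple {n : ℕ} (v : Fin (2 * n + 1) → Circ) :
    toInfiniteSphere (ofTuple (odd_two_mul_add_one n) v) = sphereIncl (2 * n + 1) (momentSphere n v) := by
  obtain ⟨t, ht, h⟩ := toInfiniteSphere_spec (ofTuple (odd_two_mul_add_one n) v)
  obtain ⟨s, hs, h'⟩ := sphereIncl_momentSphere v
  rw [moment_ofTuple] at h
  refine InfiniteSphere.eq_of_forall_eq_mul (div_pos ht hs) fun i => ?_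
  rw [h, h']
  field_simp

/-- Both sets are represented at a common level, where finitely many moments already determine the
region. -/
lemma eq_of_moment_eq {U V : MaxtameSpace} {t : ℝ} (ht : 0 < t)
    (h : ∀ i, moment U i = t * moment V i) : U = V := by
  obtain ⟨n, hn⟩ := exists_ofTuple_of_le U
  obtain ⟨k, hk⟩ := exists_ofTuple_of_le V
  obtain ⟨v, rfl⟩ := hn (max n k) (le_max_left _ _)
  obtain ⟨w, rfl⟩ := hk (max n k) (le_max_right _ _)
  rw [moment_ofTuple, moment_ofTuple] at h
  exact Subtype.ext (signRegion_eq_of_tupleMoment ht fun i _ => h i)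

lemma injective_toInfiniteSphere : Function.Injective toInfiniteSphere := by
  intro U V hUV
  obtain ⟨t, ht, h⟩ := toInfiniteSphere_spec U
  obtain ⟨s, hs, h'⟩ := toInfiniteSphere_spec V
  refine eq_of_moment_eq (t := s / t) (div_pos hs ht) fun i => ?_
  refine eq_smul_of_shear_eq (n := i + 1) (div_pos hs ht).le (fun j _ => ?_) i (Nat.lt_succ_self i)
  have h1 := h j
  rw [hUV, h'] at h1
  field_simp
  linarith

lemma surjective_toInfiniteSphere : Function.Surjective toInfiniteSphere := by
  intro p
  obtain ⟨n, hn⟩ := p.exists_bound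
  have hp : ∀ i, 2 * n + 1 + 1 ≤ i → p.1 i = 0 := fun i hi => hn i (by omega)
  obtain ⟨v, hv⟩ := surjective_momentSphere n (InfiniteSphere.restrict (2 * n + 1) p hp)
  exact ⟨ofTuple (odd_two_mul_add_one n) v, by
    rw [toInfiniteSphere_ofTuple, hv, InfiniteSphere.sphereIncl_restrict]⟩

/-- The configuration space of maxtame sets is homeomorphic to the infinite sphere. -/
noncomputable def homeomorphInfiniteSphere : MaxtameSpace ≃ₜ InfiniteSphere where
  toEquiv := Equiv.ofBijective toInfiniteSphere
    ⟨injective_toInfiniteSphere, surjective_toInfiniteSphere⟩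
  continuous_toFun := by
    refine continuous_dom ?_
    rintro _ ⟨n, rfl⟩
    have h : (fun v => toInfiniteSphere (ofTuple (odd_two_mul_add_one n) v)) =
        sphereIncl (2 * n + 1) ∘ momentSphere n := funext toInfiniteSphere_ofTuple
    change Continuous fun v => toInfiniteSphere (ofTuple (odd_two_mul_add_one n) v)
    rw [h]
    exact (InfiniteSphere.continuous_sphereIncl _).comp (continuous_momentSphere n)
  continuous_invFun := by
    -- On each odd sphere the inverse is tested after the quotient map `momentSphere n`, where it
    -- becomes `ofTuple`.
    refine InfiniteSphere.continuous_dom fun n => ?_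
    rw [(isQuotientMap_momentSphere n).continuous_iff]
    convert continuous_ofTuple (odd_two_mul_add_one n) using 1
    ext v : 1
    simp only [Function.comp_apply, Equiv.invFun_as_coe]
    rw [← toInfiniteSphere_ofTuple]
    exact Equiv.ofBijective_symm_apply_apply _ _ _

end MaxtameSpace

/-! ### The double cover -/

lemma isOpenQuotientMap_toRPLine : IsOpenQuotientMap toRPLine where
  surjective := toRPLine_surjective
  continuous := continuous_quotient_mk'
  isOpenMap := by
    intro O hO
    have hq : Topology.IsQuotientMap toRPLine := isQuotientMap_quot_mk
    rw [← hq.isOpen_preimage]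
    have : toRPLine ⁻¹' (toRPLine '' O) = O ∪ (fun x => -x) ⁻¹' O := by
      ext x
      constructor
      · rintro ⟨y, hy, hyx⟩
        rcases toRPLine_eq_iff.mp hyx with rfl | rfl
        · exact Or.inl hy
        · exact Or.inr hy
      · rintro (hx | hx)
        · exact ⟨x, hx, rfl⟩
        · exact ⟨-x, hx, toRPLine_neg x⟩
    rw [this]
    exact hO.union (hO.preimage continuous_neg)

lemma continuous_toOddConfig {l : ℕ} (hl : Odd l) : Continuous (toOddConfig l hl) :=
  continuous_iSup_rng (i := l) (continuous_iSup_rng (i := hl) continuous_coinduced_rng)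

lemma isOpen_oddConfig_iff {s : Set OddConfig} :
    IsOpen s ↔ ∀ (l : ℕ) (hl : Odd l), IsOpen (toOddConfig l hl ⁻¹' s) := by
  constructor
  · intro h l hl
    exact h.preimage (continuous_toOddConfig hl)
  · intro h
    refine isOpen_iSup_iff.mpr fun l => isOpen_iSup_iff.mpr fun hl => ?_
    exact isOpen_coinduced.mpr (h l hl)

namespace MaxtameSpace

/-- Finite products of the open quotient map `S^1 → ℝP^1` are again quotient maps, so both final
topologies can be tested on tuples of circle points. -/
lemma isQuotientMap_boundaryConfig : Topology.IsQuotientMap boundaryConfig := by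
  have hcomp : ∀ (l : ℕ) (hl : Odd l), (fun v => boundaryConfig (ofTuple hl v)) =
      toOddConfig l hl ∘ Pi.map fun _ => toRPLine := fun l hl =>
    funext fun v => boundaryConfig_ofTuple hl v
  have hq : ∀ l, IsOpenQuotientMap (Pi.map fun _ : Fin l => toRPLine) := fun l =>
    IsOpenQuotientMap.piMap fun _ => isOpenQuotientMap_toRPLine
  have hcont : Continuous boundaryConfig := by
    refine continuous_dom fun l hl => ?_
    rw [hcomp l hl]
    exact (continuous_toOddConfig hl).comp (hq l).continuous
  refine ⟨Topology.isCoinducing_iff.mpr fun s => ⟨fun h => ?_, fun h => h.preimage hcont⟩,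
    boundaryConfig_surjective⟩
  rw [isOpen_oddConfig_iff]
  intro l hl
  rw [← (hq l).isQuotientMap.isOpen_preimage, ← Set.preimage_comp, ← hcomp l hl]
  exact h.preimage (continuous_ofTuple hl)

lemma continuous_moment (i : ℕ) : Continuous fun U => moment U i := by
  refine continuous_dom fun l hl => ?_
  simp only [moment_ofTuple]
  exact continuous_tupleMoment i

lemma continuous_antipode : Continuous antipode := by
  refine continuous_dom fun l hl => ?_
  simp only [antipode_ofTuple]
  exact (continuous_ofTuple hl).comp continuous_neg

lemma exists_moment_ne_zero (U : MaxtameSpace) : ∃ i, moment U i ≠ 0 := by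
  obtain ⟨n, hn⟩ := exists_ofTuple_of_le U
  obtain ⟨v, rfl⟩ := hn n le_rfl
  obtain ⟨i, -, hi⟩ := exists_tupleMoment_ne_zero v
  exact ⟨i, by rwa [moment_ofTuple]⟩

/-- The action of the group of order two by the antipodal map. -/
noncomputable instance : MulAction ℤˣ MaxtameSpace where
  smul u U := if u = 1 then U else antipode U
  one_smul U := if_pos rfl
  mul_smul u w U := by
    change (if u * w = 1 then U else antipode U) =
      if u = 1 then (if w = 1 then U else antipode U) else
        antipode (if w = 1 then U else antipode U)
    rcases Int.units_eq_one_or u with rfl | rfl <;> rcases Int.units_eq_one_or w with rfl | rfl <;>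
      simp [antipode_antipode]

lemma neg_one_smul (U : MaxtameSpace) : (-1 : ℤˣ) • U = antipode U := if_neg (by decide)

lemma isQuotientCoveringMap_boundaryConfig : IsQuotientCoveringMap boundaryConfig ℤˣ where
  toIsQuotientMap := isQuotientMap_boundaryConfig
  continuous_const_smul u := by
    rcases Int.units_eq_one_or u with rfl | rfl
    · simpa only [one_smul] using continuous_id'
    · simpa only [neg_one_smul] using continuous_antipode
  apply_eq_iff_mem_orbit {U V} := by
    rw [boundaryConfig_eq_boundaryConfig_iff, MulAction.mem_orbit_iff]
    constructor
    · rintro (rfl | rfl)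
      · exact ⟨1, one_smul _ _⟩
      · exact ⟨-1, neg_one_smul _⟩
    · rintro ⟨u, rfl⟩
      rcases Int.units_eq_one_or u with rfl | rfl
      · exact Or.inl (one_smul _ _)
      · exact Or.inr (neg_one_smul _)
  disjoint U := by
    -- The sign of a nonzero moment separates a neighbourhood of `U` from its antipodal translate.
    obtain ⟨i, hi⟩ := exists_moment_ne_zero U
    refine ⟨{V | 0 < moment U i * moment V i}, (isOpen_lt continuous_const
      (continuous_const.mul (continuous_moment i))).mem_nhds (mul_self_pos.mpr hi), fun u hu => ?_⟩
    rcases Int.units_eq_one_or u with rfl | rfl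
    · rfl
    · exfalso
      obtain ⟨_, ⟨V, hV, rfl⟩, hV'⟩ := hu
      have h1 : 0 < moment U i * moment V i := hV
      have h2 : 0 < moment U i * moment ((-1 : ℤˣ) • V) i := hV'
      rw [neg_one_smul, moment_antipode] at h2
      linarith

/-- After padding to a common level, any two points lie in the continuous image of one connected
torus. -/
lemma connectedSpace : ConnectedSpace MaxtameSpace := by
  have hpre : IsPreconnected (Set.univ : Set MaxtameSpace) := by
    refine isPreconnected_of_forall_pair fun U _ V _ => ?_
    obtain ⟨n, hn⟩ := exists_ofTuple_of_le U
    obtain ⟨k, hk⟩ := exists_ofTuple_of_le V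
    exact ⟨Set.range (ofTuple (odd_two_mul_add_one (max n k))), Set.subset_univ _,
      hn _ (le_max_left _ _), hk _ (le_max_right _ _), isPreconnected_range (continuous_ofTuple _)⟩
  have : PreconnectedSpace MaxtameSpace := ⟨hpre⟩
  exact { toNonempty := ⟨ofTuple (odd_two_mul_add_one 0) fun _ => mk 1 0 (by norm_num)⟩ }

end MaxtameSpace

theorem mainTheorem7 :
    (∀ l : ℕ, Odd l → ∀ v : Fin l → Circ, IsMaxtame (signRegion v)) ∧
    (∃ π : MaxtameSpace → OddConfig,
      (∀ U : MaxtameSpace, frontier U.1 = toRPLine ⁻¹' ((π U).1 : Set RPLine)) ∧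
      (∀ F : OddConfig, (π ⁻¹' {F}).ncard = 2) ∧
      IsCoveringMap π) ∧
    ConnectedSpace MaxtameSpace ∧
    Nonempty (MaxtameSpace ≃ₜ InfiniteSphere) :=
  ⟨fun _ hl v => isMaxtame_signRegion hl v,
    ⟨boundaryConfig, frontier_eq_boundaryConfig, MaxtameSpace.ncard_fiber,
      MaxtameSpace.isQuotientCoveringMap_boundaryConfig.isCoveringMap⟩,
    MaxtameSpace.connectedSpace, ⟨MaxtameSpace.homeomorphInfiniteSphere⟩⟩
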